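/- Let $p_0,p_1,\dots,p_n$ be general points of the complex projective plane (that is, $(p_0,\dots,p_n)$ lies in a suitable nonempty Zariski open subset of $(\mathbb{P}^2)^{n+1}$), and let $\mathcal{L}(d,m_0,n,m)$ denote the linear system of plane curves of degree $d$ with multiplicity at least $m_0$ at $p_0$ and at least $m$ at each of $p_1,\dots,p_n$, where $d,m_0,n,m$ are non-negative integers. Its self-intersection and genus are given by $\mathcal{L}^2=d^2-m_0^2-nm^2$ and $2g_{\mathcal{L}}-2=d(d-3)-m_0(m_0-1)-nm(m-1)$. Call $\mathcal{L}(d,m_0,n,m)$ a quasi-homogeneous $(-1)$-class if $\mathcal{L}^2=-1$ and $g_{\mathcal{L}}=0$. A $(-1)$-curve is an irreducible rational plane curve whose proper transform on the blowup of the plane at $p_0,\dots,p_n$ is smooth of self-intersection $-1$. A quasi-homogeneous $(-1)$-class is called irreducible if, for general points $p_0,\dots,p_n$, the system contains a $(-1)$-curve. Proposition. (a) All quasi-homogeneous $(-1)$-classes $\mathcal{L}(d,m_0,n,1)$ are irreducible. (b) For every integer $m\ge 2$, $\mathcal{L}(m^2+m,\,m^2-1,\,2m+3,\,m)$ is an irreducible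 quasi-homogeneous $(-1)$-class. (c) All quasi-homogeneous $(-1)$-classes $\mathcal{L}(d,m_0,n,m)$ with $m\le 6$ are irreducible. (d) $\mathcal{L}(27,17,9,7)$ is a quasi-homogeneous $(-1)$-class which is not irreducible; indeed, for general points $p_0,\dots,p_9$ the system contains no $(-1)$-curve. -/

import Mathlib

open MvPolynomial
open scoped LinearAlgebra.Projectivization

noncomputable section

namespace PlaneCurves

/-- The complex projective plane. -/
abbrev Plane : Type := ℙ ℂ (Fin 3 → ℂ)

/-- Forms in three variables; a nonzero form of degree `d`, up to a scalar, is a plane curve of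
degree `d`. -/
abbrev Form : Type := MvPolynomial (Fin 3) ℂ

/-- The Taylor expansion of `F` at `p`, that is, the polynomial `F (p + X)`. -/
def taylorAt (F : Form) (p : Fin 3 → ℂ) : MvPolynomial (Fin 3) ℂ :=
  aeval (fun i => C (p i) + X i) F

/-- The multiplicity (order of vanishing) of a nonzero `F` at `p`: the smallest degree of a
nonzero homogeneous part of the Taylor expansion. For a form `F` and homogeneous coordinates `p`
of a point, this is the multiplicity of the plane curve `F = 0` at that point. -/
def multAt (F : Form) (p : Fin 3 → ℂ) : ℕ :=
  sInf {k : ℕ | homogeneousComponent k (taylorAt F p) ≠ 0}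

/-- Members of the linear system of plane curves of degree `d` with multiplicity at least `μ i`
at the point `P i`, for every `i`. -/
structure IsMember {N : ℕ} (d : ℕ) (μ : Fin N → ℕ) (P : Fin N → Plane) (F : Form) : Prop where
  ne_zero : F ≠ 0
  homogeneous : F.IsHomogeneous d
  le_mult : ∀ i, μ i ≤ multAt F (P i).rep

/-- The curve `F = 0` is rational, that is, birational to the projective line: it has a point
`(x 0 : x 1 : x 2)` over `ℂ(t)` whose coordinate ratios generate the field `ℂ(t)`. (When `F` is an
irreducible form, such a point is generic, and the field generated by the ratios is the function
field of the curve.) -/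
def IsRationalCurve (F : Form) : Prop :=
  ∃ x : Fin 3 → RatFunc ℂ, aeval x F = 0 ∧
    IntermediateField.adjoin ℂ (Set.range fun ij : Fin 3 × Fin 3 => x ij.1 / x ij.2) = ⊤

/-- The plane affine curve `G = 0` has no singularity at `a` (it may miss `a`). -/
def SmoothAt {σ : Type} (G : MvPolynomial σ ℂ) (a : σ → ℂ) : Prop :=
  eval a G = 0 → ∃ j, eval a (pderiv j G) ≠ 0

/-- For a basis `p, v, w` of `ℂ³`, the plane has affine coordinates `(a, b)` around the point `p`,
namely `p + a v + b w`, and the blowup at `p` has the chart `(s, u)` with `a = s`, `b = s u`, in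
which the exceptional curve is `s = 0`. This is the equation of the total transform of `F = 0`
in that chart; `s` is `X 0` and `u` is `X 1`. -/
def totalTransform (F : Form) (p v w : Fin 3 → ℂ) : MvPolynomial (Fin 2) ℂ :=
  aeval (fun i => C (p i) + X 0 * (C (v i) + X 1 * C (w i))) F

/-- The equation of the proper transform in the same chart: the total transform divided (exactly)
by the power of `s` whose exponent is the multiplicity at `p`. -/
def properTransform (F : Form) (p v w : Fin 3 → ℂ) : MvPolynomial (Fin 2) ℂ :=
  (totalTransform F p v w).divMonomial (Finsupp.single 0 (multAt F p))

/-- The proper transform of the curve `F = 0` on the blowup of the plane at the distinct points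
`P i` is smooth: the curve is smooth away from these points, and its proper transform is smooth at
every point `(0, u)` of the exceptional curves, in all the charts above. -/
structure ProperTransformSmooth {N : ℕ} (P : Fin N → Plane) (F : Form) : Prop where
  away : ∀ q : Plane, (∀ i, q ≠ P i) → SmoothAt F q.rep
  exceptional : ∀ (i : Fin N) (v w : Fin 3 → ℂ), LinearIndependent ℂ ![(P i).rep, v, w] →
    ∀ u : ℂ, SmoothAt (properTransform F (P i).rep v w) ![0, u]

/-- The self-intersection `d² - ∑ μᵢ²` of the class `d H - ∑ μᵢ Eᵢ` on the blowup. -/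
def selfIntersection {N : ℕ} (d : ℕ) (μ : Fin N → ℕ) : ℤ :=
  (d : ℤ) ^ 2 - ∑ i, (μ i : ℤ) ^ 2

/-- The arithmetic genus `g` of the class `d H - ∑ μᵢ Eᵢ` on the blowup, given by
`2 g - 2 = d (d - 3) - ∑ μᵢ (μᵢ - 1)`. -/
def arithmeticGenus {N : ℕ} (d : ℕ) (μ : Fin N → ℕ) : ℚ :=
  ((d : ℚ) * ((d : ℚ) - 3) - ∑ i, (μ i : ℚ) * ((μ i : ℚ) - 1)) / 2 + 1

/-- `F = 0` is a `(-1)`-curve of degree `d` with respect to the distinct points `P i`: an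
irreducible rational curve whose proper transform on the blowup at these points (which has the
class `d H - ∑ μᵢ Eᵢ`, where `μᵢ` is the multiplicity at `P i`) is smooth of self-intersection
`-1`. -/
structure IsMinusOneCurve {N : ℕ} (P : Fin N → Plane) (d : ℕ) (F : Form) : Prop where
  distinct : Function.Injective P
  homogeneous : F.IsHomogeneous d
  irreducible : Irreducible F
  rational : IsRationalCurve F
  smooth : ProperTransformSmooth P F
  self_intersection : selfIntersection d (fun i => multAt F (P i).rep) = -1

/-- `Q` holds for `N` general points of the plane: it holds on a nonempty Zariski open set of
`N`-tuples of points. (The images of the sets `Φ ≠ 0` form a basis of the Zariski topology of the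
`N`-fold product of the plane.) -/
def ForGeneralPoints {N : ℕ} (Q : (Fin N → Plane) → Prop) : Prop :=
  ∃ Φ : MvPolynomial (Fin N × Fin 3) ℂ, Φ ≠ 0 ∧
    ∀ (a : Fin N → Fin 3 → ℂ) (ha : ∀ i, a i ≠ 0),
      eval (fun ij => a ij.1 ij.2) Φ ≠ 0 → Q fun i => Projectivization.mk ℂ (a i) (ha i)

/-- The multiplicities of the quasi-homogeneous system `L(d, m₀, n, m)`: multiplicity `m₀` at the
first point and `m` at the `n` others. -/
def qhMult (m₀ n m : ℕ) : Fin (n + 1) → ℕ :=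
  Fin.cons m₀ fun _ => m

/-- `L(d, m₀, n, m)` is a quasi-homogeneous `(-1)`-class: `L² = -1` and `g = 0`. -/
def IsQHMinusOneClass (d m₀ n m : ℕ) : Prop :=
  selfIntersection d (qhMult m₀ n m) = -1 ∧ arithmeticGenus d (qhMult m₀ n m) = 0

/-- The system `L(d, m₀, n, m)` based at the points `P` contains a `(-1)`-curve. -/
def ContainsMinusOneCurve (d m₀ n m : ℕ) (P : Fin (n + 1) → Plane) : Prop :=
  ∃ F : Form, IsMember d (qhMult m₀ n m) P F ∧ IsMinusOneCurve P d F

/-- `L(d, m₀, n, m)` is an irreducible `(-1)`-class: a quasi-homogeneous `(-1)`-class which, based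
at `n + 1` general points, contains a `(-1)`-curve. -/
def IsIrreducibleMinusOneClass (d m₀ n m : ℕ) : Prop :=
  IsQHMinusOneClass d m₀ n m ∧ ForGeneralPoints (ContainsMinusOneCurve d m₀ n m)

end PlaneCurves

end

/-! The engine is the quadratic transformation. Based at three of the points, it sends a curve of
class (d; μ) to one of degree 2d - μ_a - μ_b - μ_c, replaces μ_a by d - μ_b - μ_c (likewise for b
and c) and leaves the other multiplicities alone. It lifts to an isomorphism of the blowups, so
irreducibility, rationality and smoothness of the proper transform survive, and it carries general
points to general points (`Generic.cremona`). Hence existence and non-existence of irreducible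
curves both pass from class to class (`GoodClass.cremona`, `generic_not_exists_cremona`).

Existence starts from the line through two points. Transformations at a fixed point and two unused
ones give the classes (d+1; d, 1^(2d+2)) (`goodClass_monoid`); further ones, centred at a new point,
give the family of (b) (`goodClass_deJonquieres`). Numerically, a (-1)-class satisfies L² = -1 and
-K·L = 1, whence (d - m₀ - m)(d + m₀ - 2m) = (2m + 1)(m - 1). For m = 1 this leaves the monoid
classes, the line and the conic; for 2 ≤ m ≤ 6, running through the divisors leaves only the family
of (b). For (27; 17, 7^9), six transformations lead to (5; 3, 3, 1^8). There the line through the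
two triple points meets the curve negatively and would be a component, so no irreducible curve
exists.

Blowups are handled through formal arcs. Multiplicity at least k means order at least k along every
arc through the point, and a singular point of the proper transform forces order at least k + 2
along all arcs with the given tangent (`SingularAlong`). As `F` composed with the transformation is
a monomial times `G`, orders along arcs are transported by counting the order of that monomial. -/

noncomputable section

namespace PlaneCurves

/-! ### Taylor expansions and multiplicities along arcs -/

theorem aeval_add_eq_aeval_taylorAt {A : Type*} [CommRing A] [Algebra ℂ A] (F : Form)
    (p : Fin 3 → ℂ) (y : Fin 3 → A) :
    aeval (fun i => algebraMap ℂ A (p i) + y i) F = aeval y (taylorAt F p) := by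
  unfold taylorAt
  rw [← AlgHom.comp_apply, comp_aeval]
  simp [algHom_C]

theorem taylorAt_ne_zero {F : Form} (hF : F ≠ 0) (p : Fin 3 → ℂ) : taylorAt F p ≠ 0 := by
  intro h
  have := aeval_add_eq_aeval_taylorAt F p (fun i => (X i - C (p i) : Form))
  rw [h, map_zero] at this
  apply hF
  rw [← this]
  simp [algebraMap_eq]

theorem aeval_mul_of_isHomogeneous {σ : Type*} {A : Type*} [CommRing A] [Algebra ℂ A]
    {H : MvPolynomial σ ℂ}
    {k : ℕ} (hH : H.IsHomogeneous k) (t : A) (y : σ → A) :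
    aeval (fun i => t * y i) H = t ^ k * aeval y H := by
  rw [aeval_def, aeval_def, eval₂_eq, eval₂_eq, Finset.mul_sum]
  refine Finset.sum_congr rfl fun m hm => ?_
  have hdeg : k = ∑ i ∈ m.support, m i := hH.degree_eq_sum_deg_support hm
  simp_rw [mul_pow, Finset.prod_mul_distrib, Finset.prod_pow_eq_pow_sum]
  rw [← hdeg]
  ring

/-- The homogeneous part of degree `k` of the Taylor expansion. -/
def jet (F : Form) (p : Fin 3 → ℂ) (k : ℕ) : Form := homogeneousComponent k (taylorAt F p)

theorem multAt_set_nonempty {F : Form} (hF : F ≠ 0) (p : Fin 3 → ℂ) :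
    {k : ℕ | homogeneousComponent k (taylorAt F p) ≠ 0}.Nonempty := by
  by_contra h
  rw [Set.not_nonempty_iff_eq_empty, Set.eq_empty_iff_forall_notMem] at h
  apply taylorAt_ne_zero hF p
  rw [← sum_homogeneousComponent (taylorAt F p)]
  exact Finset.sum_eq_zero fun k _ => by simpa using h k

theorem le_multAt_iff_jet {F : Form} (hF : F ≠ 0) (p : Fin 3 → ℂ) (k : ℕ) :
    k ≤ multAt F p ↔ ∀ j < k, jet F p j = 0 := by
  constructor
  · intro h j hj
    by_contra hne
    exact absurd (Nat.sInf_le (show j ∈ {k : ℕ | homogeneousComponent k (taylorAt F p) ≠ 0}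
      from hne)) (by unfold multAt at h; omega)
  · intro h
    refine le_csInf (multAt_set_nonempty hF p) fun j hj => ?_
    by_contra hlt
    exact hj (h j (not_le.mp hlt))

/-- Two leading terms are kept because the order `k + 2` in `SingularAlong` involves the jets of
degrees `k` and `k + 1`. -/
theorem aeval_arc_expansion {A : Type*} [CommRing A] [Algebra ℂ A] {F : Form} {p : Fin 3 → ℂ}
    {k : ℕ} (h : ∀ j < k, jet F p j = 0) (t : A) (y : Fin 3 → A) :
    ∃ R : A, aeval (fun i => algebraMap ℂ A (p i) + t * y i) F =
      t ^ k * (aeval y (jet F p k) + t * aeval y (jet F p (k + 1)) + t ^ 2 * R) := by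
  rw [aeval_add_eq_aeval_taylorAt]
  set T := taylorAt F p with hT
  have key : ∀ n, ∃ R : A, aeval (fun i => t * y i)
      (∑ j ∈ Finset.range (k + 2 + n), homogeneousComponent j T) =
      t ^ k * (aeval y (jet F p k) + t * aeval y (jet F p (k + 1)) + t ^ 2 * R) := by
    intro n
    induction n with
    | zero =>
      refine ⟨0, ?_⟩
      rw [add_zero, Finset.sum_range_succ, Finset.sum_range_succ, Finset.sum_eq_zero, zero_add,
        map_add, aeval_mul_of_isHomogeneous (homogeneousComponent_isHomogeneous _ _),
        aeval_mul_of_isHomogeneous (homogeneousComponent_isHomogeneous _ _)]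
      · unfold jet; ring
      · intro j hj; exact h j (Finset.mem_range.mp hj)
    | succ n ih =>
      obtain ⟨R, hR⟩ := ih
      refine ⟨R + t ^ n * aeval y (homogeneousComponent (k + 2 + n) T), ?_⟩
      rw [← add_assoc, Finset.sum_range_succ, map_add, hR,
        aeval_mul_of_isHomogeneous (homogeneousComponent_isHomogeneous _ _)]
      ring
  have hsum : T = ∑ j ∈ Finset.range (k + 2 + (T.totalDegree + 1)), homogeneousComponent j T := by
    conv_lhs => rw [← sum_homogeneousComponent T]
    refine Finset.sum_subset (Finset.range_subset_range.mpr (by omega)) fun j _ hj => ?_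
    exact homogeneousComponent_eq_zero _ _ (by simpa [Nat.lt_succ_iff] using hj)
  rw [hsum]
  exact key _

theorem pow_dvd_aeval {A : Type*} [CommRing A] [Algebra ℂ A] {F : Form} (hF : F ≠ 0)
    {p : Fin 3 → ℂ}
    {k : ℕ} (h : k ≤ multAt F p) (t : A) (y : Fin 3 → A) :
    t ^ k ∣ aeval (fun i => algebraMap ℂ A (p i) + t * y i) F := by
  obtain ⟨R, hR⟩ := aeval_arc_expansion ((le_multAt_iff_jet hF p k).mp h) t y
  exact ⟨_, hR⟩

/-- Formal arcs in the affine cone over the plane. -/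
abbrev Arc : Type := Fin 3 → PowerSeries ℂ

theorem constantCoeff_aeval {σ : Type*} (y : σ → PowerSeries ℂ) (H : MvPolynomial σ ℂ) :
    PowerSeries.constantCoeff (aeval y H) =
      eval (fun i => PowerSeries.constantCoeff (y i)) H := by
  induction H using MvPolynomial.induction_on with
  | C a => simp
  | add p q hp hq => simp [hp, hq]
  | mul_X p i hp => simp [hp]

theorem coeff_one_aeval {σ : Type*} [Fintype σ] (y : σ → PowerSeries ℂ) (H : MvPolynomial σ ℂ) :
    PowerSeries.coeff 1 (aeval y H) =
      ∑ j, eval (fun i => PowerSeries.constantCoeff (y i)) (pderiv j H) *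
        PowerSeries.coeff 1 (y j) := by
  classical
  induction H using MvPolynomial.induction_on with
  | C a => simp
  | add p q hp hq => simp [hp, hq, add_mul, Finset.sum_add_distrib]
  | mul_X p i hp =>
    rw [map_mul, aeval_X, PowerSeries.coeff_mul, Finset.Nat.antidiagonal_succ]
    have hsum : ∑ j, eval (fun i => PowerSeries.constantCoeff (y i)) (pderiv j (p * X i)) *
        PowerSeries.coeff 1 (y j) = eval (fun i => PowerSeries.constantCoeff (y i)) p *
          PowerSeries.coeff 1 (y i) + (∑ j, eval (fun i => PowerSeries.constantCoeff (y i))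
            (pderiv j p) * PowerSeries.coeff 1 (y j)) * PowerSeries.constantCoeff (y i) := by
      rw [Finset.sum_mul, ← Fintype.sum_pi_single i fun j =>
        eval (fun i => PowerSeries.constantCoeff (y i)) p * PowerSeries.coeff 1 (y j),
        ← Finset.sum_add_distrib]
      refine Finset.sum_congr rfl fun j _ => ?_
      rw [Derivation.leibniz, pderiv_X]
      by_cases h : i = j
      · subst h; simp; ring
      · simp [h]; ring
    rw [hsum]
    simp [hp]

theorem exists_sub_eq_X_mul (γ : Arc) :
    ∃ y : Arc, (∀ i, γ i = algebraMap ℂ _ (PowerSeries.constantCoeff (γ i)) +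
      PowerSeries.X * y i) ∧
      (∀ i n, PowerSeries.coeff n (y i) = PowerSeries.coeff (n + 1) (γ i)) := by
  refine ⟨fun i => PowerSeries.mk fun n => PowerSeries.coeff (n + 1) (γ i), fun i => ?_,
    fun i n => by simp⟩
  rw [PowerSeries.algebraMap_apply, add_comm]
  exact PowerSeries.eq_X_mul_shift_add_const (γ i)

theorem X_pow_dvd_aeval_of_le_multAt {F : Form} (hF : F ≠ 0) {p : Fin 3 → ℂ} {k : ℕ}
    (h : k ≤ multAt F p) (γ : Arc) (hγ : ∀ i, PowerSeries.constantCoeff (γ i) = p i) :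
    PowerSeries.X ^ k ∣ aeval γ F := by
  obtain ⟨y, hy, -⟩ := exists_sub_eq_X_mul γ
  rw [funext hy]
  simp_rw [hγ]
  exact pow_dvd_aeval hF h _ _

/-- The arc `p + s v`. -/
def lineArc (p v : Fin 3 → ℂ) : Arc := fun i =>
  algebraMap ℂ _ (p i) + PowerSeries.X * algebraMap ℂ _ (v i)

/-- The first nonzero jet of degree below `k` would be a polynomial in the direction `v` vanishing
wherever `Ψ` does not, hence zero. So straight arcs in general directions already detect the
multiplicity. -/
theorem le_multAt_of_generic {F : Form} (hF : F ≠ 0) {p : Fin 3 → ℂ} {k : ℕ}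
    {Ψ : MvPolynomial (Fin 3) ℂ} (hΨ : Ψ ≠ 0)
    (h : ∀ v, eval v Ψ ≠ 0 → PowerSeries.X ^ k ∣ aeval (lineArc p v) F) : k ≤ multAt F p := by
  rw [le_multAt_iff_jet hF]
  intro j
  induction j using Nat.strong_induction_on with
  | _ j ih =>
  intro hj
  have hz : jet F p j * Ψ = 0 := by
    refine MvPolynomial.funext fun v => ?_
    rw [map_zero, map_mul, mul_eq_zero]
    by_cases hv : eval v Ψ = 0
    · exact Or.inr hv
    left
    obtain ⟨R, hR⟩ := aeval_arc_expansion (F := F) (p := p) (k := j)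
      (fun i hi => ih i hi (hi.trans hj)) (PowerSeries.X : PowerSeries ℂ)
      (fun i => algebraMap ℂ _ (v i))
    have h1 := h v hv
    unfold lineArc at h1
    rw [hR] at h1
    have h2 := (pow_dvd_pow (PowerSeries.X : PowerSeries ℂ) (Nat.succ_le_of_lt hj)).trans h1
    rw [pow_succ, mul_dvd_mul_iff_left (pow_ne_zero _ PowerSeries.X_ne_zero),
      PowerSeries.X_dvd_iff] at h2
    simpa [constantCoeff_aeval, PowerSeries.algebraMap_apply] using h2
  exact (mul_eq_zero.mp hz).resolve_right hΨ

theorem le_multAt_of_forall_arc {F : Form} (hF : F ≠ 0) {p : Fin 3 → ℂ} {k : ℕ}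
    (h : ∀ γ : Arc, (∀ i, PowerSeries.constantCoeff (γ i) = p i) →
      PowerSeries.X ^ k ∣ aeval γ F) : k ≤ multAt F p :=
  le_multAt_of_generic hF one_ne_zero fun v _ => h _ fun i => by
    simp [lineArc]

/-! ### Singularities of proper transforms along arcs -/

/-- The curve `F = 0`, of multiplicity `k` at `p`, has order at least `k + 2` along all arcs through
`p` with tangent direction `v`; this is the case when its proper transform is singular at the
corresponding point of the exceptional curve. -/
def SingularAlong (F : Form) (p v : Fin 3 → ℂ) (k : ℕ) : Prop :=
  ∀ (γ : Arc) (c α β : ℂ), c ≠ 0 → α ≠ 0 → (∀ i, PowerSeries.constantCoeff (γ i) = c * p i) →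
    (∀ i, PowerSeries.coeff 1 (γ i) = α * v i + β * p i) → PowerSeries.X ^ (k + 2) ∣ aeval γ F

theorem isUnit_of_constantCoeff_ne_zero {f : PowerSeries ℂ}
    (h : PowerSeries.constantCoeff f ≠ 0) : IsUnit f :=
  PowerSeries.isUnit_iff_constantCoeff.mpr (isUnit_iff_ne_zero.mpr h)

theorem multAt_le_multAt_smul {F : Form} (hF : F ≠ 0) {d : ℕ} (hd : F.IsHomogeneous d)
    {c : ℂ} (hc : c ≠ 0) (p : Fin 3 → ℂ) : multAt F p ≤ multAt F (c • p) := by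
  refine le_multAt_of_forall_arc hF fun γ hγ => ?_
  have h := X_pow_dvd_aeval_of_le_multAt hF (le_refl (multAt F p))
    (fun i => algebraMap ℂ _ c⁻¹ * γ i) fun i => by
      simp [hγ, hc]
  rw [aeval_mul_of_isHomogeneous hd] at h
  refine ((IsUnit.pow d ?_).dvd_mul_left).mp h
  exact isUnit_of_constantCoeff_ne_zero (by simpa using hc)

theorem multAt_smul {F : Form} (hF : F ≠ 0) {d : ℕ} (hd : F.IsHomogeneous d)
    {c : ℂ} (hc : c ≠ 0) (p : Fin 3 → ℂ) : multAt F (c • p) = multAt F p := by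
  refine le_antisymm ?_ (multAt_le_multAt_smul hF hd hc p)
  have := multAt_le_multAt_smul hF hd (inv_ne_zero hc) (c • p)
  rwa [smul_smul, inv_mul_cancel₀ hc, one_smul] at this

theorem SingularAlong.of_smul {F : Form} {p v : Fin 3 → ℂ} {k : ℕ} {c : ℂ} (hc : c ≠ 0)
    (h : SingularAlong F (c • p) v k) : SingularAlong F p v k := by
  intro γ c' α β hc' hα h0 h1
  refine h γ (c' / c) α (β / c) (div_ne_zero hc' hc) hα (fun i => ?_) fun i => ?_
  · rw [h0, Pi.smul_apply, smul_eq_mul]; field_simp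
  · rw [h1, Pi.smul_apply, smul_eq_mul]; field_simp

theorem X_sq_dvd_iff {f : PowerSeries ℂ} :
    PowerSeries.X ^ 2 ∣ f ↔ PowerSeries.constantCoeff f = 0 ∧ PowerSeries.coeff 1 f = 0 := by
  rw [PowerSeries.X_pow_dvd_iff]
  constructor
  · intro h
    exact ⟨by simpa using h 0 (by norm_num), h 1 (by norm_num)⟩
  · rintro ⟨h0, h1⟩ m hm
    interval_cases m
    · simpa using h0
    · exact h1

theorem totalTransform_eq {F : Form} (hF : F ≠ 0) (p v w : Fin 3 → ℂ) :
    totalTransform F p v w = X 0 ^ multAt F p * properTransform F p v w := by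
  obtain ⟨G, hG⟩ := pow_dvd_aeval (A := MvPolynomial (Fin 2) ℂ) hF (le_refl (multAt F p)) (X 0)
    (fun i => C (v i) + X 1 * C (w i))
  have hT : totalTransform F p v w = X 0 ^ multAt F p * G := hG
  unfold properTransform
  rw [hT, X_pow_eq_monomial, divMonomial_monomial_mul]

/-- The arc lifts to the blowup chart and passes there through `(0, u)`. The total transform is a
power of `s` times the proper transform; the former contributes the multiplicity to the order, the
latter at least two more. -/
theorem singularAlong_of_not_smoothAt {F : Form} (hF : F ≠ 0) {d : ℕ} (hd : F.IsHomogeneous d)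
    {p v w : Fin 3 → ℂ} (hli : LinearIndependent ℂ ![p, v, w]) {u : ℂ}
    (h : ¬ SmoothAt (properTransform F p v w) ![0, u]) :
    SingularAlong F p (v + u • w) (multAt F p) := by
  intro γ c α β hc hα h0 h1
  -- `N` inverts the basis matrix; `a` below gives the coordinates of the arc in the basis `p, v,
  -- w`.
  obtain ⟨N, hN⟩ : ∃ N : Matrix (Fin 3) (Fin 3) ℂ, Matrix.of ![p, v, w] * N = 1 ∧
      N * Matrix.of ![p, v, w] = 1 := by
    have : IsUnit (Matrix.of ![p, v, w]) := by
      rw [← Matrix.linearIndependent_rows_iff_isUnit]; exact hli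
    obtain ⟨U, hU⟩ := this
    exact ⟨U.inv, by rw [← hU]; simp⟩
  obtain ⟨hMN, hNM⟩ := hN
  have hM : ∀ i j, ∑ k, (![p, v, w] i) k * N k j = if i = j then 1 else 0 := fun i j => by
    have := congrFun (congrFun hMN i) j
    rwa [Matrix.mul_apply, Matrix.one_apply] at this
  have hM' : ∀ i j, ∑ k, N i k * (![p, v, w] k) j = if i = j then 1 else 0 := fun i j => by
    have := congrFun (congrFun hNM i) j
    rwa [Matrix.mul_apply, Matrix.one_apply] at this
  set a : Fin 3 → PowerSeries ℂ := fun k => ∑ i, PowerSeries.C (N i k) * γ i with ha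
  have hp : ∀ j, ∑ k, p k * N k j = if 0 = j then 1 else 0 := hM 0
  have hv : ∀ j, ∑ k, v k * N k j = if 1 = j then 1 else 0 := hM 1
  have hw : ∀ j, ∑ k, w k * N k j = if 2 = j then 1 else 0 := hM 2
  have ha0 : ∀ k, PowerSeries.constantCoeff (a k) = if 0 = k then c else 0 := fun k => by
    have : PowerSeries.constantCoeff (a k) = c * ∑ i, p i * N i k := by
      simp only [ha, map_sum, map_mul, h0, Finset.mul_sum, PowerSeries.constantCoeff_C]
      exact Finset.sum_congr rfl fun i _ => by ring
    rw [this, hp]; simp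
  have ha1 : ∀ k, PowerSeries.coeff 1 (a k) = α * (if 1 = k then 1 else 0) +
      α * u * (if 2 = k then 1 else 0) + β * (if 0 = k then 1 else 0) := fun k => by
    have : PowerSeries.coeff 1 (a k) = α * (∑ i, v i * N i k) + α * u * (∑ i, w i * N i k) +
        β * (∑ i, p i * N i k) := by
      simp only [ha, map_sum, PowerSeries.coeff_C_mul, h1, Finset.mul_sum,
        ← Finset.sum_add_distrib, Pi.add_apply, Pi.smul_apply, smul_eq_mul]
      exact Finset.sum_congr rfl fun i _ => by ring
    rw [this, hp, hv, hw]
  have hγ : ∀ j, γ j = a 0 * PowerSeries.C (p j) + a 1 * PowerSeries.C (v j) +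
      a 2 * PowerSeries.C (w j) := fun j => by
    have : ∑ k, a k * PowerSeries.C ((![p, v, w] k) j) = ∑ i, γ i * PowerSeries.C
        (∑ k, N i k * (![p, v, w] k) j) := by
      simp only [ha, Finset.sum_mul, map_sum, Finset.mul_sum, map_mul]
      rw [Finset.sum_comm]
      exact Finset.sum_congr rfl fun i _ => Finset.sum_congr rfl fun k _ => by ring
    rw [Fin.sum_univ_three] at this
    simp only [hM'] at this
    simpa using this.symm
  obtain ⟨b, hb⟩ := PowerSeries.X_dvd_iff.mpr ((ha0 1).trans (by simp))
  obtain ⟨e, he⟩ := PowerSeries.X_dvd_iff.mpr ((ha0 2).trans (by simp))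
  have hb0 : PowerSeries.constantCoeff b = α := by
    have := ha1 1
    rw [hb, ← zero_add 1, PowerSeries.coeff_succ_X_mul] at this
    simpa using this
  have he0 : PowerSeries.constantCoeff e = α * u := by
    have := ha1 2
    rw [he, ← zero_add 1, PowerSeries.coeff_succ_X_mul] at this
    simpa using this
  have hb' : b * b⁻¹ = 1 := PowerSeries.mul_inv_cancel _ (by rwa [hb0])
  have ha' : a 0 * (a 0)⁻¹ = 1 := PowerSeries.mul_inv_cancel _ (by rw [ha0]; simpa using hc)
  -- The lifted arc: `s = a 1 / a 0` and `u = a 2 / a 1`, with a common factor `X` cancelled in the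
  -- second.
  set σ : PowerSeries ℂ := PowerSeries.X * (b * (a 0)⁻¹) with hσ
  set ρ : PowerSeries ℂ := e * b⁻¹ with hρ
  have hρ0 : PowerSeries.constantCoeff ρ = u := by
    rw [hρ, map_mul, PowerSeries.constantCoeff_inv, hb0, he0]; field_simp
  have hγ' : γ = fun j => a 0 * aeval ![σ, ρ]
      (C (p j) + X 0 * (C (v j) + X 1 * C (w j)) : MvPolynomial (Fin 2) ℂ) := by
    funext j
    rw [hγ j, hb, he]
    simp only [map_add, map_mul, algHom_C, aeval_X, Matrix.cons_val_zero, Matrix.cons_val_one,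
      hσ, hρ, PowerSeries.algebraMap_apply, Algebra.algebraMap_self, RingHom.id_apply]
    linear_combination (-PowerSeries.X * b * PowerSeries.C (v j) -
      PowerSeries.X * e * b * b⁻¹ * PowerSeries.C (w j)) * ha' -
      PowerSeries.X * e * PowerSeries.C (w j) * hb'
  rw [hγ', aeval_mul_of_isHomogeneous hd]
  have hcomp : aeval (fun j => aeval ![σ, ρ]
      (C (p j) + X 0 * (C (v j) + X 1 * C (w j)) : MvPolynomial (Fin 2) ℂ)) F =
      aeval ![σ, ρ] (totalTransform F p v w) := by
    unfold totalTransform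
    rw [← AlgHom.comp_apply, comp_aeval]
  rw [hcomp, totalTransform_eq hF, map_mul, map_pow, aeval_X, Matrix.cons_val_zero, pow_add]
  refine Dvd.dvd.mul_left (mul_dvd_mul (pow_dvd_pow_of_dvd ⟨_, hσ⟩ _) ?_) _
  unfold SmoothAt at h
  push Not at h
  have hcc : (fun i => PowerSeries.constantCoeff ((![σ, ρ] : Fin 2 → PowerSeries ℂ) i)) =
      ![0, u] := by
    funext i
    fin_cases i
    · simp [hσ]
    · simpa using hρ0
  rw [X_sq_dvd_iff, constantCoeff_aeval, coeff_one_aeval, hcc]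
  exact ⟨h.1, Finset.sum_eq_zero fun j _ => by rw [h.2, zero_mul]⟩

theorem X_pow_dvd_aeval_add_two_iff {F : Form} (hF : F ≠ 0) {p : Fin 3 → ℂ} {k : ℕ}
    (hk : k ≤ multAt F p) (y : Arc) :
    PowerSeries.X ^ (k + 2) ∣
      aeval (fun i => algebraMap ℂ (PowerSeries ℂ) (p i) + PowerSeries.X * y i) F ↔
    eval (fun i => PowerSeries.constantCoeff (y i)) (jet F p k) = 0 ∧
    (∑ j, eval (fun i => PowerSeries.constantCoeff (y i)) (pderiv j (jet F p k)) *
        PowerSeries.coeff 1 (y j)) +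
      eval (fun i => PowerSeries.constantCoeff (y i)) (jet F p (k + 1)) = 0 := by
  obtain ⟨R, hR⟩ := aeval_arc_expansion ((le_multAt_iff_jet hF p k).mp hk)
    (PowerSeries.X : PowerSeries ℂ) y
  rw [hR, pow_add, mul_dvd_mul_iff_left (pow_ne_zero _ PowerSeries.X_ne_zero),
    dvd_add_left (Dvd.intro _ rfl), X_sq_dvd_iff, map_add, map_add, constantCoeff_aeval,
    coeff_one_aeval]
  rw [← zero_add 1, PowerSeries.coeff_succ_X_mul, PowerSeries.coeff_zero_eq_constantCoeff_apply,
    constantCoeff_aeval]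
  simp

/-- With the tangent fixed, order at least `k + 2` is an affine condition on the second-order
coefficients of the arc, so it may be checked off the hyperplane where the coefficient in coordinate
`a` vanishes. -/
theorem singularAlong_of_generic {F : Form} (hF : F ≠ 0) {d : ℕ} (hd : F.IsHomogeneous d)
    {p v : Fin 3 → ℂ} {k : ℕ} (hk : k ≤ multAt F p) (a : Fin 3)
    (h : ∀ (γ : Arc) (c α β : ℂ), c ≠ 0 → α ≠ 0 →
      (∀ i, PowerSeries.constantCoeff (γ i) = c * p i) →
      (∀ i, PowerSeries.coeff 1 (γ i) = α * v i + β * p i) → PowerSeries.coeff 2 (γ a) ≠ 0 →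
      PowerSeries.X ^ (k + 2) ∣ aeval γ F) : SingularAlong F p v k := by
  intro γ c α β hc hα h0 h1
  by_cases h2 : PowerSeries.coeff 2 (γ a) = 0
  swap
  · exact h γ c α β hc hα h0 h1 h2
  obtain ⟨y, hy, hyc⟩ := exists_sub_eq_X_mul γ
  set z : ℂ → Arc := fun t i => PowerSeries.C c⁻¹ *
    (y i + PowerSeries.C t * (if i = a then PowerSeries.X else 0)) with hz
  set δ : ℂ → Arc := fun t i => γ i + PowerSeries.C t * PowerSeries.X ^ 2 *
    (if i = a then 1 else 0) with hδ
  have hδz : ∀ t, δ t = fun i => PowerSeries.C c * (algebraMap ℂ (PowerSeries ℂ) (p i) +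
      PowerSeries.X * z t i) := fun t => by
    funext i
    have hcc : PowerSeries.C c * PowerSeries.C c⁻¹ = (1 : PowerSeries ℂ) := by
      rw [← map_mul, mul_inv_cancel₀ hc, map_one]
    simp only [hδ, hz, PowerSeries.algebraMap_apply, Algebra.algebraMap_self, RingHom.id_apply]
    rw [hy i, h0]
    simp only [PowerSeries.algebraMap_apply, Algebra.algebraMap_self, RingHom.id_apply, map_mul]
    split_ifs
    · linear_combination (-PowerSeries.X * (y i + PowerSeries.C t * PowerSeries.X)) * hcc
    · linear_combination (-PowerSeries.X * y i) * hcc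
  have hCc : IsUnit ((PowerSeries.C c : PowerSeries ℂ) ^ d) :=
    (isUnit_of_constantCoeff_ne_zero (by simpa using hc)).pow d
  have key : ∀ t, PowerSeries.X ^ (k + 2) ∣ aeval (δ t) F ↔ PowerSeries.X ^ (k + 2) ∣
      aeval (fun i => algebraMap ℂ (PowerSeries ℂ) (p i) + PowerSeries.X * z t i) F := fun t => by
    rw [hδz, aeval_mul_of_isHomogeneous hd]
    exact hCc.dvd_mul_left
  have hgood : ∀ t, t ≠ 0 → PowerSeries.X ^ (k + 2) ∣ aeval (δ t) F := fun t ht => by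
    refine h (δ t) c α β hc hα (fun i => ?_) (fun i => ?_) ?_
    · simp only [hδ, map_add, h0]
      split_ifs <;> simp
    · simp only [hδ, map_add, h1, mul_assoc, PowerSeries.coeff_C_mul, PowerSeries.coeff_X_pow_mul']
      simp
    · simp [hδ, h2, ht, PowerSeries.coeff_C_mul, PowerSeries.coeff_X_pow]
  have hγ0 : γ = δ 0 := by funext i; simp [hδ]
  have hz0 : ∀ t, (fun i => PowerSeries.constantCoeff (z t i)) =
      fun i => PowerSeries.constantCoeff (z 0 i) := fun t => by
    funext i
    simp only [hz, map_mul, map_add]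
    split_ifs <;> simp
  have hz1 : ∀ t j, PowerSeries.coeff 1 (z t j) = PowerSeries.coeff 1 (z 0 j) +
      t * (if j = a then c⁻¹ else 0) := fun t j => by
    simp only [hz, PowerSeries.coeff_C_mul, map_add]
    split_ifs <;> simp
    ring
  -- An affine function of `t` that vanishes at `1` and `2` vanishes at `0`.
  have e1 := (X_pow_dvd_aeval_add_two_iff hF hk _).mp ((key 1).mp (hgood 1 one_ne_zero))
  have e2 := (X_pow_dvd_aeval_add_two_iff hF hk _).mp ((key 2).mp (hgood 2 two_ne_zero))
  rw [hγ0, key, X_pow_dvd_aeval_add_two_iff hF hk]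
  rw [hz0 1] at e1
  rw [hz0 2] at e2
  refine ⟨e1.1, ?_⟩
  have e1' := e1.2
  have e2' := e2.2
  simp only [hz1 1] at e1'
  simp only [hz1 2] at e2'
  simp only [mul_add, Finset.sum_add_distrib] at e1' e2'
  have e3 : ∀ f : Fin 3 → ℂ, ∑ j, f j * (2 * if j = a then c⁻¹ else 0) =
      2 * ∑ j, f j * (1 * if j = a then c⁻¹ else 0) := fun f => by
    rw [Finset.mul_sum]; exact Finset.sum_congr rfl fun j _ => by ring
  rw [e3] at e2'
  linear_combination 2 * e1' - e2'

/-! ### Coordinate points -/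

/-- The coordinate points of the plane. -/
def coordPoint (a : Fin 3) : Fin 3 → ℂ := Pi.single a 1

theorem eq_or_eq_or_eq {a b c : Fin 3} (hab : a ≠ b) (hac : a ≠ c) (hbc : b ≠ c) (i : Fin 3) :
    i = a ∨ i = b ∨ i = c := by
  revert a b c i; decide

theorem univ_eq_of_distinct {a b c : Fin 3} (hab : a ≠ b) (hac : a ≠ c) (hbc : b ≠ c) :
    (Finset.univ : Finset (Fin 3)) = {a, b, c} := by
  revert a b c; decide

theorem sum_eq_of_distinct {M : Type*} [AddCommMonoid M] {a b c : Fin 3} (hab : a ≠ b)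
    (hac : a ≠ c) (hbc : b ≠ c) (f : Fin 3 → M) : ∑ i, f i = f a + f b + f c := by
  rw [univ_eq_of_distinct hab hac hbc, Finset.sum_insert (by simp [hab, hac]),
    Finset.sum_insert (by simpa using hbc), Finset.sum_singleton, add_assoc]

theorem prod_eq_of_distinct {M : Type*} [CommMonoid M] {a b c : Fin 3} (hab : a ≠ b)
    (hac : a ≠ c) (hbc : b ≠ c) (f : Fin 3 → M) : ∏ i, f i = f a * f b * f c := by
  rw [univ_eq_of_distinct hab hac hbc, Finset.prod_insert (by simp [hab, hac]),
    Finset.prod_insert (by simpa using hbc), Finset.prod_singleton, mul_assoc]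

theorem degree_eq_of_mem_support {F : Form} {d : ℕ} (hd : F.IsHomogeneous d) {m : Fin 3 →₀ ℕ}
    (hm : m ∈ F.support) : ∑ i, m i = d := by
  rw [hd.degree_eq_sum_deg_support hm]
  exact (Finset.sum_subset (Finset.subset_univ _) fun i _ hi => by simpa using hi).symm

theorem aeval_eq_sum {A : Type*} [CommRing A] [Algebra ℂ A] (F : Form) (y : Fin 3 → A) :
    aeval y F = ∑ m ∈ F.support, algebraMap ℂ A (coeff m F) * ∏ i, y i ^ m i := by
  rw [aeval_def, eval₂_eq']

theorem monomial_eq_prod (m : Fin 3 →₀ ℕ) (r : ℂ) :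
    (monomial m r : Form) = C r * ∏ i, X i ^ m i := by
  rw [monomial_eq, Finsupp.prod_fintype]
  simp

/-- At a coordinate point distinct monomials stay distinct in the Taylor expansion, so nothing
cancels and the multiplicity can be read off the exponents. The variable `X a`, no longer needed as
a coordinate, serves as the parameter of the arc. -/
theorem add_le_of_le_multAt_coordPoint {F : Form} (hF : F ≠ 0) {d : ℕ} (hd : F.IsHomogeneous d)
    {a : Fin 3} {k : ℕ} (hk : k ≤ multAt F (coordPoint a)) {m : Fin 3 →₀ ℕ} (hm : m ∈ F.support) :
    k + m a ≤ d := by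
  classical
  by_contra hlt
  obtain ⟨H, hH⟩ := pow_dvd_aeval (A := Form) hF hk (X a) (fun i => if i = a then 0 else X i)
  let τ : (Fin 3 →₀ ℕ) → (Fin 3 →₀ ℕ) := fun n => n.update a (d - n a)
  have hterm : ∀ n ∈ F.support, ∏ i, (algebraMap ℂ Form (coordPoint a i) +
      X a * (if i = a then 0 else X i)) ^ n i = monomial (τ n) 1 := fun n hn => by
    have hdeg := degree_eq_of_mem_support hd hn
    rw [monomial_eq_prod, C_1, one_mul, ← Finset.mul_prod_erase _ _ (Finset.mem_univ a),
      ← Finset.mul_prod_erase _ _ (Finset.mem_univ a)]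
    have h1 : ∀ i ∈ Finset.univ.erase a, (algebraMap ℂ Form (coordPoint a i) +
      X a * (if i = a then 0 else X i)) ^ n i = X a ^ n i * X i ^ n i := fun i hi => by
      have hi' : i ≠ a := Finset.ne_of_mem_erase hi
      simp [coordPoint, hi', mul_pow]
    have h2 : ∀ i ∈ Finset.univ.erase a, (X i : Form) ^ τ n i = X i ^ n i := fun i hi => by
      simp [τ, Finset.ne_of_mem_erase hi]
    rw [Finset.prod_congr rfl h1, Finset.prod_congr rfl h2, Finset.prod_mul_distrib,
      Finset.prod_pow_eq_pow_sum]
    have h3 : ∑ i ∈ Finset.univ.erase a, n i = d - n a := by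
      rw [← hdeg, ← Finset.add_sum_erase _ _ (Finset.mem_univ a)]; omega
    simp [h3, coordPoint, τ]
  rw [aeval_eq_sum, Finset.sum_congr rfl fun n hn => by rw [hterm n hn]] at hH
  have hco := congrArg (coeff (τ m)) hH
  rw [coeff_sum, Finset.sum_eq_single m, X_pow_eq_monomial, coeff_monomial_mul', if_neg] at hco
  · simp only [algebraMap_eq, coeff_C_mul, coeff_monomial, if_true, mul_one] at hco
    exact (mem_support_iff.mp hm) hco
  · intro hle
    have := hle a
    simp [τ] at this
    have hdeg := degree_eq_of_mem_support hd hm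
    rw [← Finset.add_sum_erase _ _ (Finset.mem_univ a)] at hdeg
    omega
  · intro n hn hnm
    simp only [algebraMap_eq, coeff_C_mul, coeff_monomial]
    rw [if_neg, mul_zero]
    intro heq
    apply hnm
    have hna : ∀ i, i ≠ a → n i = m i := fun i hi => by
      have := DFunLike.congr_fun heq i
      simpa [τ, hi] using this
    have e1 := degree_eq_of_mem_support hd hn
    have e2 := degree_eq_of_mem_support hd hm
    rw [← Finset.add_sum_erase _ _ (Finset.mem_univ a)] at e1 e2
    have e3 : ∑ i ∈ Finset.univ.erase a, n i = ∑ i ∈ Finset.univ.erase a, m i :=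
      Finset.sum_congr rfl fun i hi => hna i (Finset.ne_of_mem_erase hi)
    ext i
    by_cases hi : i = a
    · subst hi; omega
    · exact hna i hi
  · intro h; exact absurd hm h

theorem le_multAt_coordPoint {F : Form} (hF : F ≠ 0) {d : ℕ} (hd : F.IsHomogeneous d)
    {a : Fin 3} {k : ℕ} (h : ∀ m ∈ F.support, k + m a ≤ d) : k ≤ multAt F (coordPoint a) := by
  refine le_multAt_of_forall_arc hF fun γ hγ => ?_
  rw [aeval_eq_sum]
  refine Finset.dvd_sum fun m hm => Dvd.dvd.mul_left ?_ _
  rw [← Finset.mul_prod_erase _ _ (Finset.mem_univ a)]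
  refine Dvd.dvd.mul_left ?_ _
  have hdvd : ∏ i ∈ Finset.univ.erase a, (PowerSeries.X : PowerSeries ℂ) ^ m i ∣
      ∏ i ∈ Finset.univ.erase a, γ i ^ m i := by
    refine Finset.prod_dvd_prod_of_dvd _ _ fun i hi => pow_dvd_pow_of_dvd ?_ _
    rw [PowerSeries.X_dvd_iff, hγ]
    simp [coordPoint, Finset.ne_of_mem_erase hi]
  refine Dvd.dvd.trans ?_ hdvd
  rw [Finset.prod_pow_eq_pow_sum]
  refine pow_dvd_pow _ ?_
  have := degree_eq_of_mem_support hd hm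
  rw [← Finset.add_sum_erase _ _ (Finset.mem_univ a)] at this
  have := h m hm
  omega

theorem le_multAt_coordPoint_iff {F : Form} (hF : F ≠ 0) {d : ℕ} (hd : F.IsHomogeneous d)
    {a : Fin 3} {k : ℕ} : k ≤ multAt F (coordPoint a) ↔ ∀ m ∈ F.support, k + m a ≤ d :=
  ⟨fun hk _ hm => add_le_of_le_multAt_coordPoint hF hd hk hm, le_multAt_coordPoint hF hd⟩

theorem exists_mem_support_of_not_X_dvd {F : Form} {a : Fin 3} (h : ¬ X a ∣ F) :
    ∃ m ∈ F.support, m a = 0 := by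
  by_contra hno
  push Not at hno
  apply h
  rw [← support_sum_monomial_coeff F]
  refine Finset.dvd_sum fun m hm => ?_
  rw [X_dvd_monomial]
  exact Or.inr (hno m hm)

theorem exists_mem_support_add_multAt {F : Form} (hF : F ≠ 0) {d : ℕ} (hd : F.IsHomogeneous d)
    (a : Fin 3) : ∃ m ∈ F.support, multAt F (coordPoint a) + m a = d := by
  by_contra hno
  push Not at hno
  have : multAt F (coordPoint a) + 1 ≤ multAt F (coordPoint a) := by
    refine le_multAt_coordPoint hF hd fun m hm => ?_
    have := add_le_of_le_multAt_coordPoint hF hd (le_refl (multAt F (coordPoint a))) hm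
    have := hno m hm
    omega
  omega

theorem not_X_dvd_of_mem_support {F : Form} {a : Fin 3} {m : Fin 3 →₀ ℕ} (hm : m ∈ F.support)
    (h : m a = 0) : ¬ X a ∣ F := by
  rintro ⟨G, rfl⟩
  rw [mem_support_iff, coeff_X_mul', if_neg (by simpa using h)] at hm
  exact hm rfl

/-- A curve meeting a coordinate line in too many points contains the line. -/
theorem X_dvd_of_lt_multAt_add_multAt {F : Form} (hF : F ≠ 0) {d : ℕ} (hd : F.IsHomogeneous d)
    {a b c : Fin 3} (hab : a ≠ b) (hac : a ≠ c) (hbc : b ≠ c)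
    (h : d < multAt F (coordPoint b) + multAt F (coordPoint c)) : X a ∣ F := by
  by_contra hno
  obtain ⟨m, hm, hma⟩ := exists_mem_support_of_not_X_dvd hno
  have h1 := add_le_of_le_multAt_coordPoint hF hd (le_refl (multAt F (coordPoint b))) hm
  have h2 := add_le_of_le_multAt_coordPoint hF hd (le_refl (multAt F (coordPoint c))) hm
  have h3 := degree_eq_of_mem_support hd hm
  rw [sum_eq_of_distinct hab hac hbc] at h3
  omega

/-! ### Linear changes of coordinates -/

section Linear

variable {A : Type*} [CommRing A] [Algebra ℂ A]

/-- The action of matrices on vectors over a `ℂ`-algebra. -/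
def act (g : Matrix (Fin 3) (Fin 3) ℂ) (y : Fin 3 → A) : Fin 3 → A := fun i =>
  ∑ j, algebraMap ℂ A (g i j) * y j

theorem act_act (g h : Matrix (Fin 3) (Fin 3) ℂ) (y : Fin 3 → A) :
    act g (act h y) = act (g * h) y := by
  funext i
  simp only [act, Matrix.mul_apply, map_sum, map_mul, Finset.mul_sum, Finset.sum_mul]
  rw [Finset.sum_comm]
  simp only [mul_assoc]

theorem act_one (y : Fin 3 → A) : act 1 y = y := by
  funext i
  simp [act, Matrix.one_apply]

theorem act_smul (g : Matrix (Fin 3) (Fin 3) ℂ) (c : ℂ) (p : Fin 3 → ℂ) :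
    act g (c • p) = c • act g p := by
  funext i
  simp only [act, Pi.smul_apply, smul_eq_mul, Finset.mul_sum]
  exact Finset.sum_congr rfl fun j _ => by ring

theorem act_add (g : Matrix (Fin 3) (Fin 3) ℂ) (p q : Fin 3 → ℂ) :
    act g (p + q) = act g p + act g q := by
  funext i
  simp [act, mul_add, Finset.sum_add_distrib]

/-- Linear substitution in a form. -/
def substLin (g : Matrix (Fin 3) (Fin 3) ℂ) : Form →ₐ[ℂ] Form := aeval (act g X)

theorem aeval_substLin (g : Matrix (Fin 3) (Fin 3) ℂ) (F : Form) (y : Fin 3 → A) :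
    aeval y (substLin g F) = aeval (act g y) F := by
  unfold substLin
  rw [← AlgHom.comp_apply, comp_aeval]
  congr 2
  funext i
  simp [act, algHom_C]

theorem substLin_substLin {g h : Matrix (Fin 3) (Fin 3) ℂ} (hgh : g * h = 1) (F : Form) :
    substLin h (substLin g F) = F := by
  have := aeval_substLin g F (act h (X : Fin 3 → Form))
  rw [act_act, hgh, act_one, aeval_X_left_apply] at this
  exact this

theorem substLin_ne_zero {g h : Matrix (Fin 3) (Fin 3) ℂ} (hgh : g * h = 1) {F : Form}
    (hF : F ≠ 0) : substLin g F ≠ 0 := by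
  intro h0
  apply hF
  rw [← substLin_substLin hgh F, h0, map_zero]

theorem isHomogeneous_substLin (g : Matrix (Fin 3) (Fin 3) ℂ) {F : Form} {d : ℕ}
    (hd : F.IsHomogeneous d) : (substLin g F).IsHomogeneous d := by
  have := hd.aeval (g := act g (X : Fin 3 → Form)) (n := 1) fun i => by
    refine IsHomogeneous.sum _ _ _ fun j _ => ?_
    exact isHomogeneous_C_mul_X _ _
  rwa [one_mul] at this

theorem irreducible_substLin {g h : Matrix (Fin 3) (Fin 3) ℂ} (hgh : g * h = 1) (hhg : h * g = 1)
    {F : Form} (hF : Irreducible F) : Irreducible (substLin g F) := by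
  let e : Form ≃ₐ[ℂ] Form := AlgEquiv.ofAlgHom (substLin g) (substLin h)
    (AlgHom.ext fun G => substLin_substLin hhg G) (AlgHom.ext fun G => substLin_substLin hgh G)
  exact (MulEquiv.irreducible_iff e).mpr hF

theorem coeff_act (g : Matrix (Fin 3) (Fin 3) ℂ) (γ : Arc) (n : ℕ) (i : Fin 3) :
    PowerSeries.coeff n (act g γ i) = act g (fun j => PowerSeries.coeff n (γ j)) i := by
  simp [act, PowerSeries.coeff_C_mul]

theorem multAt_substLin {g h : Matrix (Fin 3) (Fin 3) ℂ} (hgh : g * h = 1) (hhg : h * g = 1)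
    {F : Form} (hF : F ≠ 0) (p : Fin 3 → ℂ) : multAt (substLin g F) p = multAt F (act g p) := by
  have aux : ∀ {g h : Matrix (Fin 3) (Fin 3) ℂ} (_ : g * h = 1) {F : Form} (_ : F ≠ 0)
      (p : Fin 3 → ℂ), multAt F (act g p) ≤ multAt (substLin g F) p := by
    intro g h hgh F hF p
    refine le_multAt_of_forall_arc (substLin_ne_zero hgh hF) fun γ hγ => ?_
    rw [aeval_substLin]
    refine X_pow_dvd_aeval_of_le_multAt hF le_rfl _ fun i => ?_
    rw [← PowerSeries.coeff_zero_eq_constantCoeff_apply, coeff_act]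
    simp only [PowerSeries.coeff_zero_eq_constantCoeff_apply, hγ]
  refine le_antisymm ?_ (aux hgh hF p)
  have := aux hhg (substLin_ne_zero hgh hF) (act g p)
  rwa [act_act, hhg, act_one, substLin_substLin hgh] at this

theorem SingularAlong.of_substLin {g h : Matrix (Fin 3) (Fin 3) ℂ} (hgh : g * h = 1)
    (hhg : h * g = 1) {F : Form} {p v : Fin 3 → ℂ} {k : ℕ} (hs : SingularAlong (substLin g F) p v k) :
    SingularAlong F (act g p) (act g v) k := by
  intro γ c α β hc hα h0 h1
  have := hs (act h γ) c α β hc hα (fun i => ?_) fun i => ?_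
  · rwa [aeval_substLin, act_act, hgh, act_one] at this
  · rw [← PowerSeries.coeff_zero_eq_constantCoeff_apply, coeff_act]
    simp only [PowerSeries.coeff_zero_eq_constantCoeff_apply, h0]
    have := act_smul h c (act g p)
    rw [act_act, hhg, act_one] at this
    exact congrFun this i
  · rw [coeff_act]
    simp only [h1]
    have := act_add h (α • act g v) (β • act g p)
    rw [act_smul, act_smul, act_act, act_act, hhg, act_one, act_one] at this
    exact congrFun this i

end Linear

/-! ### The standard quadratic transformation -/

section Cremona

variable {A : Type*} [CommRing A]

/-- The standard quadratic transformation `(x : y : z) ↦ (y z : x z : x y)`. -/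
def crem (y : Fin 3 → A) : Fin 3 → A := fun i => ∏ j ∈ Finset.univ.erase i, y j

theorem crem_apply {a b c : Fin 3} (hab : a ≠ b) (hac : a ≠ c) (hbc : b ≠ c) (y : Fin 3 → A) :
    crem y a = y b * y c := by
  unfold crem
  rw [univ_eq_of_distinct hab hac hbc, Finset.erase_insert (by simp [hab, hac]),
    Finset.prod_insert (by simpa using hbc), Finset.prod_singleton]

theorem crem_zero (y : Fin 3 → A) : crem y 0 = y 1 * y 2 :=
  crem_apply (by decide) (by decide) (by decide) y

theorem crem_one (y : Fin 3 → A) : crem y 1 = y 0 * y 2 :=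
  crem_apply (by decide) (by decide) (by decide) y

theorem crem_two (y : Fin 3 → A) : crem y 2 = y 0 * y 1 :=
  crem_apply (by decide) (by decide) (by decide) y

theorem crem_crem (y : Fin 3 → A) : crem (crem y) = fun i => (∏ j, y j) * y i := by
  funext i
  rw [Fin.prod_univ_three]
  fin_cases i <;> simp [crem_zero, crem_one, crem_two] <;> ring

theorem map_crem {B : Type*} [CommRing B] (f : A →+* B) (y : Fin 3 → A) (i : Fin 3) :
    f (crem y i) = crem (fun j => f (y j)) i := by
  simp [crem]

theorem aeval_cremForm [Algebra ℂ A] (F : Form) (y : Fin 3 → A) :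
    aeval y (aeval (crem (X : Fin 3 → Form)) F) = aeval (crem y) F := by
  rw [← AlgHom.comp_apply, comp_aeval]
  congr 2
  funext i
  simp [crem]

end Cremona

/-- The effect of the quadratic transformation on exponents. -/
def cremExp (m : Fin 3 →₀ ℕ) : Fin 3 →₀ ℕ :=
  Finsupp.equivFunOnFinite.symm fun i => ∑ j ∈ Finset.univ.erase i, m j

theorem cremExp_add (m : Fin 3 →₀ ℕ) (i : Fin 3) : m i + cremExp m i = ∑ j, m j :=
  Finset.add_sum_erase _ _ (Finset.mem_univ i)

theorem cremExp_injective : Function.Injective cremExp := by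
  intro m n h
  have e : ∀ i, cremExp m i = cremExp n i := fun i => by rw [h]
  have h0 := cremExp_add m 0
  have h1 := cremExp_add m 1
  have h2 := cremExp_add m 2
  have k0 := cremExp_add n 0
  have k1 := cremExp_add n 1
  have k2 := cremExp_add n 2
  have e0 := e 0
  have e1 := e 1
  have e2 := e 2
  rw [Fin.sum_univ_three] at *
  ext i
  fin_cases i <;> simp <;> omega

theorem prod_crem_pow (m : Fin 3 →₀ ℕ) :
    ∏ i, crem (X : Fin 3 → Form) i ^ m i = monomial (cremExp m) 1 := by
  rw [monomial_eq_prod, C_1, one_mul]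
  have h0 := cremExp_add m 0
  have h1 := cremExp_add m 1
  have h2 := cremExp_add m 2
  rw [Fin.sum_univ_three] at *
  rw [Fin.prod_univ_three, Fin.prod_univ_three, show cremExp m 0 = m 1 + m 2 by omega,
    show cremExp m 1 = m 0 + m 2 by omega, show cremExp m 2 = m 0 + m 1 by omega, crem_zero,
    crem_one, crem_two]
  ring

theorem cremForm_eq_sum (F : Form) : aeval (crem (X : Fin 3 → Form)) F =
    ∑ m ∈ F.support, monomial (cremExp m) (coeff m F) := by
  rw [aeval_eq_sum]
  refine Finset.sum_congr rfl fun m _ => ?_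
  rw [prod_crem_pow, algebraMap_eq, C_mul_monomial, mul_one]

theorem coeff_sum_monomial {F : Form} {τ : (Fin 3 →₀ ℕ) → Fin 3 →₀ ℕ}
    (hτ : Set.InjOn τ F.support) {m : Fin 3 →₀ ℕ} (hm : m ∈ F.support) :
    coeff (τ m) (∑ n ∈ F.support, monomial (τ n) (coeff n F)) = coeff m F := by
  classical
  rw [coeff_sum, Finset.sum_eq_single m]
  · simp
  · intro n hn hnm
    rw [coeff_monomial, if_neg fun h => hnm (hτ hn hm h)]
  · intro h; exact absurd hm h

/-- Two forms that correspond to each other under the standard quadratic transformation; `μ` and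
`ν` are their multiplicities at the coordinate points. -/
structure CremonaPair (d e : ℕ) (μ ν : Fin 3 → ℕ) (F G : Form) : Prop where
  left_ne : F ≠ 0
  right_ne : G ≠ 0
  left_hom : F.IsHomogeneous d
  right_hom : G.IsHomogeneous e
  left_mult : ∀ a, multAt F (coordPoint a) = μ a
  right_mult : ∀ a, multAt G (coordPoint a) = ν a
  left_rel : aeval (crem (X : Fin 3 → Form)) F = (∏ i, X i ^ μ i) * G
  right_rel : aeval (crem (X : Fin 3 → Form)) G = (∏ i, X i ^ ν i) * F
  left_sum : ∀ a b c : Fin 3, a ≠ b → a ≠ c → b ≠ c → ν a + μ b + μ c = d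
  right_sum : ∀ a b c : Fin 3, a ≠ b → a ≠ c → b ≠ c → μ a + ν b + ν c = e
  left_not_dvd : ∀ a, ¬ X a ∣ F
  right_not_dvd : ∀ a, ¬ X a ∣ G

theorem CremonaPair.symm {d e : ℕ} {μ ν : Fin 3 → ℕ} {F G : Form}
    (P : CremonaPair d e μ ν F G) : CremonaPair e d ν μ G F where
  left_ne := P.right_ne
  right_ne := P.left_ne
  left_hom := P.right_hom
  right_hom := P.left_hom
  left_mult := P.right_mult
  right_mult := P.left_mult
  left_rel := P.right_rel
  right_rel := P.left_rel
  left_sum := P.right_sum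
  right_sum := P.left_sum
  left_not_dvd := P.right_not_dvd
  right_not_dvd := P.left_not_dvd

/-- The substitution turns the exponent `m i` into `d - m i`, and dividing by `X i ^ μ i` leaves `ρ
m`. A monomial of `F` free of `X a` makes the multiplicity of `G` exact; a monomial attaining the
multiplicity of `F` shows that `X a` does not divide `G`. -/
theorem exists_cremonaPair {F : Form} {d e : ℕ} (hd : F.IsHomogeneous d) {μ ν : Fin 3 → ℕ}
    (hX : ∀ a, ¬ X a ∣ F) (hμ : ∀ a, multAt F (coordPoint a) = μ a)
    (hν : ∀ a b c : Fin 3, a ≠ b → a ≠ c → b ≠ c → ν a + μ b + μ c = d)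
    (he : e + ∑ i, μ i = 2 * d) : ∃ G, CremonaPair d e μ ν F G := by
  have hF : F ≠ 0 := by rintro rfl; exact hX 0 (dvd_zero _)
  let ρ : (Fin 3 →₀ ℕ) → Fin 3 →₀ ℕ := fun m =>
    Finsupp.equivFunOnFinite.symm fun i => d - μ i - m i
  have hle : ∀ m ∈ F.support, ∀ i, μ i + m i ≤ d := fun m hm i =>
    add_le_of_le_multAt_coordPoint hF hd (hμ i).ge hm
  have hρ : ∀ m ∈ F.support, ∀ i, ρ m i + μ i + m i = d := fun m hm i => by
    have := hle m hm i
    simp only [ρ, Finsupp.equivFunOnFinite_symm_apply_apply]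
    omega
  have hinj : Set.InjOn ρ F.support := fun m hm n hn h => by
    ext i
    have h1 := hρ m hm i
    have h2 := hρ n hn i
    rw [h] at h1
    omega
  set G : Form := ∑ m ∈ F.support, monomial (ρ m) (coeff m F) with hG
  have hco : ∀ m ∈ F.support, coeff (ρ m) G = coeff m F := fun m hm => coeff_sum_monomial hinj hm
  have hmem : ∀ m ∈ F.support, ρ m ∈ G.support := fun m hm => by
    rw [mem_support_iff, hco m hm]; exact mem_support_iff.mp hm
  have hsupp : ∀ n ∈ G.support, ∃ m ∈ F.support, ρ m = n := fun n hn => by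
    classical
    by_contra hno
    push Not at hno
    rw [mem_support_iff, hG, coeff_sum] at hn
    apply hn
    refine Finset.sum_eq_zero fun m hm => ?_
    rw [coeff_monomial, if_neg (hno m hm)]
  have hsum3 : ∀ f : Fin 3 → ℕ, ∀ a b c : Fin 3, a ≠ b → a ≠ c → b ≠ c →
      ∑ i, f i = f a + f b + f c := fun f a b c hab hac hbc => sum_eq_of_distinct hab hac hbc f
  have hhom : G.IsHomogeneous e := by
    refine IsHomogeneous.sum _ _ _ fun m hm => isHomogeneous_monomial _ ?_
    have h1 := degree_eq_of_mem_support hd hm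
    have h2 := hρ m hm
    have h3 : (ρ m).degree = ∑ i, ρ m i := by
      rw [Finsupp.degree_apply]
      exact Finset.sum_subset (Finset.subset_univ _) fun i _ hi => by simpa using hi
    rw [h3, Fin.sum_univ_three]
    rw [Fin.sum_univ_three] at h1 he
    have := h2 0
    have := h2 1
    have := h2 2
    omega
  have hGne : G ≠ 0 := by
    obtain ⟨m, hm, -⟩ := exists_mem_support_of_not_X_dvd (hX 0)
    exact fun h0 => by simpa [h0] using hmem m hm
  have hother : ∀ a : Fin 3, ∃ b c : Fin 3, a ≠ b ∧ a ≠ c ∧ b ≠ c := by decide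
  have hlrel : aeval (crem (X : Fin 3 → Form)) F = (∏ i, X i ^ μ i) * G := by
    have hmon : (∏ i, X i ^ μ i : Form) =
        monomial (Finsupp.equivFunOnFinite.symm μ) 1 := by
      rw [monomial_eq_prod]; simp
    rw [cremForm_eq_sum, hG, Finset.mul_sum, hmon]
    refine Finset.sum_congr rfl fun m hm => ?_
    have hexp : cremExp m = Finsupp.equivFunOnFinite.symm μ + ρ m := by
      ext i
      have h1 := cremExp_add m i
      have h2 := hρ m hm i
      rw [degree_eq_of_mem_support hd hm] at h1
      simp only [Finsupp.coe_add, Pi.add_apply, Finsupp.equivFunOnFinite_symm_apply_apply]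
      omega
    rw [monomial_mul, one_mul, hexp]
  refine ⟨G, hF, hGne, hd, hhom, hμ, fun a => ?_, hlrel, ?_, hν, fun a b c hab hac hbc => ?_, hX,
    fun a => ?_⟩
  · obtain ⟨b, c, hab, hac, hbc⟩ := hother a
    have hs := hsum3 μ a b c hab hac hbc
    have hs' := hν a b c hab hac hbc
    refine le_antisymm ?_ ?_
    · obtain ⟨m, hm, hma⟩ := exists_mem_support_of_not_X_dvd (hX a)
      have h1 := add_le_of_le_multAt_coordPoint hGne hhom (le_refl (multAt G (coordPoint a)))
        (hmem m hm)
      have h2 := hρ m hm a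
      omega
    · rw [le_multAt_coordPoint_iff hGne hhom]
      intro n hn
      obtain ⟨m, hm, rfl⟩ := hsupp n hn
      have h2 := hρ m hm a
      omega
  · have h1 := aeval_cremForm F (crem (X : Fin 3 → Form))
    rw [hlrel, map_mul, map_prod, crem_crem, aeval_mul_of_isHomogeneous hd,
      aeval_X_left_apply] at h1
    simp only [map_pow, aeval_X] at h1
    have hne : ∏ i, crem (X : Fin 3 → Form) i ^ μ i ≠ 0 := by
      rw [Finset.prod_ne_zero_iff]
      intro i _
      exact pow_ne_zero _ (Finset.prod_ne_zero_iff.mpr fun j _ => X_ne_zero j)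
    refine mul_left_cancel₀ hne ?_
    rw [h1, ← mul_assoc]
    congr 1
    have e0 := hν 0 1 2 (by decide) (by decide) (by decide)
    have e1 := hν 1 0 2 (by decide) (by decide) (by decide)
    have e2 := hν 2 0 1 (by decide) (by decide) (by decide)
    rw [Fin.prod_univ_three, Fin.prod_univ_three, Fin.prod_univ_three, mul_pow, mul_pow, crem_zero,
      crem_one, crem_two]
    nth_rw 1 [← e0]
    nth_rw 1 [← e1]
    rw [← e2]
    ring
  · have h1 := hν b a c (Ne.symm hab) hbc hac
    have h2 := hν c a b (Ne.symm hac) (Ne.symm hbc) hab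
    have h3 := hsum3 μ a b c hab hac hbc
    omega
  · obtain ⟨m, hm, hma⟩ := exists_mem_support_add_multAt hF hd a
    refine not_X_dvd_of_mem_support (hmem m hm) ?_
    have := hρ m hm a
    have := hμ a
    omega

theorem CremonaPair.aeval_left {d e : ℕ} {μ ν : Fin 3 → ℕ} {F G : Form}
    (P : CremonaPair d e μ ν F G) {A : Type*} [CommRing A] [Algebra ℂ A] (y : Fin 3 → A) :
    aeval (crem y) F = (∏ i, y i ^ μ i) * aeval y G := by
  rw [← aeval_cremForm, P.left_rel, map_mul, map_prod]
  simp

/-- If `G = A * B`, the prime `F` divides the transform of one factor. The transform of the other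
then divides a monomial, so that factor is itself a monomial, hence constant since no `X a` divides
`G`. -/
theorem CremonaPair.irreducible {d e : ℕ} {μ ν : Fin 3 → ℕ} {F G : Form}
    (P : CremonaPair d e μ ν F G) (hF : Irreducible F) : Irreducible G := by
  have aux : ∀ A B : Form, G = A * B → F ∣ aeval (crem (X : Fin 3 → Form)) A → IsUnit B := by
    rintro A B hAB ⟨H, hH⟩
    have h1 := P.right_rel
    rw [hAB, map_mul, hH, mul_assoc, mul_comm _ F] at h1
    have h2 := mul_left_cancel₀ P.left_ne h1
    have hmon : (∏ i, X i ^ ν i : Form) = monomial (Finsupp.equivFunOnFinite.symm ν) 1 := by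
      rw [monomial_eq_prod]; simp
    rw [hmon] at h2
    obtain ⟨n, r, -, -, hn⟩ := (dvd_monomial_iff_exists one_ne_zero).mp (Dvd.intro_left _ h2)
    have hB : ∀ m ∈ B.support, cremExp m = n := fun m hm => by
      classical
      have h3 := coeff_sum_monomial (F := B) cremExp_injective.injOn hm
      rw [← cremForm_eq_sum, hn, coeff_monomial] at h3
      by_contra hne
      rw [if_neg (Ne.symm hne)] at h3
      exact mem_support_iff.mp hm h3.symm
    have hB0 : ∀ m ∈ B.support, m = 0 := fun m hm => by
      ext a
      by_contra hne
      apply P.right_not_dvd a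
      rw [hAB]
      refine Dvd.dvd.mul_left ?_ _
      rw [← support_sum_monomial_coeff B]
      refine Finset.dvd_sum fun m' hm' => ?_
      rw [X_dvd_monomial, cremExp_injective ((hB m' hm').trans (hB m hm).symm)]
      exact Or.inr hne
    have hBC : B = C (coeff 0 B) := by
      ext m
      rw [coeff_C]
      split_ifs with h
      · rw [h]
      · by_contra hne
        exact h (hB0 m (mem_support_iff.mpr hne)).symm
    have hBne : B ≠ 0 := by rintro rfl; exact P.right_ne (by rw [hAB, mul_zero])
    rw [hBC]
    refine (isUnit_iff_ne_zero.mpr fun h0 => hBne ?_).map C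
    rw [hBC, h0, C_0]
  refine ⟨fun hu => ?_, fun A B hAB => ?_⟩
  · have h1 : IsUnit ((∏ i, X i ^ ν i : Form) * F) := by rw [← P.right_rel]; exact hu.map _
    exact hF.not_isUnit (isUnit_of_mul_isUnit_right h1)
  · have h1 : F ∣ aeval (crem (X : Fin 3 → Form)) A * aeval (crem (X : Fin 3 → Form)) B := by
      rw [← map_mul, ← hAB, P.right_rel]; exact Dvd.intro_left _ rfl
    rcases hF.prime.dvd_or_dvd h1 with h | h
    · exact Or.inr (aux A B hAB h)
    · exact Or.inl (aux B A (by rw [hAB, mul_comm]) h)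

/-! ### Singularities under the quadratic transformation -/

theorem isUnit_prod_pow {δ : Arc} (h : ∀ i, PowerSeries.constantCoeff (δ i) ≠ 0) (ν : Fin 3 → ℕ) :
    IsUnit (∏ i, δ i ^ ν i) :=
  (isUnit_of_constantCoeff_ne_zero (by
    rw [map_prod, Finset.prod_ne_zero_iff]
    intro i _
    rw [map_pow]
    exact pow_ne_zero _ (h i)))

theorem constantCoeff_crem (δ : Arc) (i : Fin 3) : PowerSeries.constantCoeff (crem δ i) =
    crem (fun j => PowerSeries.constantCoeff (δ j)) i := map_crem _ _ _

theorem coeff_one_mul (f g : PowerSeries ℂ) : PowerSeries.coeff 1 (f * g) =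
    PowerSeries.constantCoeff f * PowerSeries.coeff 1 g +
      PowerSeries.coeff 1 f * PowerSeries.constantCoeff g := by
  rw [PowerSeries.coeff_mul, Finset.Nat.antidiagonal_succ]
  simp

/-- The differential of the quadratic transformation. -/
def dcrem (p v : Fin 3 → ℂ) : Fin 3 → ℂ :=
  ![p 1 * v 2 + v 1 * p 2, p 0 * v 2 + v 0 * p 2, p 0 * v 1 + v 0 * p 1]

theorem coeff_one_crem (δ : Arc) (i : Fin 3) : PowerSeries.coeff 1 (crem δ i) =
    dcrem (fun j => PowerSeries.constantCoeff (δ j)) (fun j => PowerSeries.coeff 1 (δ j)) i := by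
  fin_cases i <;> simp [dcrem, crem_zero, crem_one, crem_two, coeff_one_mul]

theorem crem_ne_zero {K : Type*} [Field K] {p : Fin 3 → K} (hp : ∀ i, p i ≠ 0) (i : Fin 3) :
    crem p i ≠ 0 :=
  Finset.prod_ne_zero_iff.mpr fun j _ => hp j

/-- Off the coordinate lines `dcrem p` is invertible, and it sends `p` to `2 • crem p`. -/
theorem eq_smul_of_dcrem_eq_smul {p v : Fin 3 → ℂ} (hp : ∀ i, p i ≠ 0) {c : ℂ}
    (h : dcrem p v = c • crem p) : v = (c / 2) • p := by
  have h0 := congrFun h 0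
  have h1 := congrFun h 1
  have h2 := congrFun h 2
  simp only [dcrem, Pi.smul_apply, smul_eq_mul, crem_zero, crem_one, crem_two,
    Matrix.cons_val_zero, Matrix.cons_val_one, Matrix.cons_val] at h0 h1 h2
  have p0 := hp 0
  have p1 := hp 1
  have p2 := hp 2
  funext i
  fin_cases i
  · refine mul_left_cancel₀ (mul_ne_zero p1 p2) ?_
    change p 1 * p 2 * v 0 = p 1 * p 2 * (c / 2 * p 0)
    linear_combination (p 2 * h2 + p 1 * h1 - p 0 * h0) / 2
  · refine mul_left_cancel₀ (mul_ne_zero p0 p2) ?_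
    change p 0 * p 2 * v 1 = p 0 * p 2 * (c / 2 * p 1)
    linear_combination (p 2 * h2 - p 1 * h1 + p 0 * h0) / 2
  · refine mul_left_cancel₀ (mul_ne_zero p0 p1) ?_
    change p 0 * p 1 * v 2 = p 0 * p 1 * (c / 2 * p 2)
    linear_combination (-p 2 * h2 + p 1 * h1 + p 0 * h0) / 2

section Transport

variable {d e : ℕ} {μ ν : Fin 3 → ℕ} {F G : Form}

/-- By `crem_crem`, arcs through `crem q` are sent to arcs through a multiple of `q`, and off the
coordinate lines the monomial factor is a unit. -/
theorem CremonaPair.multAt_le (P : CremonaPair d e μ ν F G) {q : Fin 3 → ℂ} (hq : ∀ i, q i ≠ 0) :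
    multAt G q ≤ multAt F (crem q) := by
  refine le_multAt_of_forall_arc P.left_ne fun δ hδ => ?_
  have hprod : ∏ i, q i ≠ 0 := Finset.prod_ne_zero_iff.mpr fun i _ => hq i
  have h := X_pow_dvd_aeval_of_le_multAt P.right_ne
    (multAt_smul P.right_ne P.right_hom hprod q).ge (crem δ) fun i => by
      rw [constantCoeff_crem]
      simp only [hδ]
      rw [crem_crem]
      rfl
  rw [P.symm.aeval_left] at h
  exact ((isUnit_prod_pow (fun i => by rw [hδ]; exact crem_ne_zero hq i) ν).dvd_mul_left).mp h

theorem CremonaPair.multAt_eq (P : CremonaPair d e μ ν F G) {q : Fin 3 → ℂ} (hq : ∀ i, q i ≠ 0) :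
    multAt G q = multAt F (crem q) := by
  refine le_antisymm (P.multAt_le hq) ?_
  have h := P.symm.multAt_le (crem_ne_zero hq)
  rw [crem_crem] at h
  have hprod : ∏ i, q i ≠ 0 := Finset.prod_ne_zero_iff.mpr fun i _ => hq i
  exact h.trans (multAt_smul P.right_ne P.right_hom hprod q).le

theorem CremonaPair.singularAlong_torus (P : CremonaPair d e μ ν F G) {p v : Fin 3 → ℂ} {k : ℕ}
    (hp : ∀ i, p i ≠ 0) (h : SingularAlong G p v k) : SingularAlong F (crem p) (dcrem p v) k := by
  intro δ c α β hc hα h0 h1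
  have hprod : ∏ i, p i ≠ 0 := Finset.prod_ne_zero_iff.mpr fun i _ => hp i
  -- The scalars come from differentiating `crem_crem`: `dcrem (crem p) (dcrem p v)` is the product
  -- of the `p i` times `v`, plus the derivative of that product along `v` times `p`.
  have hdvd := h (crem δ) (c ^ 2 * ∏ i, p i) (c * α * ∏ i, p i)
    (2 * c * β * (∏ i, p i) + c * α * (v 0 * p 1 * p 2 + v 1 * p 0 * p 2 + v 2 * p 0 * p 1))
    (mul_ne_zero (pow_ne_zero _ hc) hprod) (mul_ne_zero (mul_ne_zero hc hα) hprod)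
    (fun i => by
      rw [constantCoeff_crem]
      simp only [h0]
      rw [Fin.prod_univ_three]
      fin_cases i <;> simp [crem_zero, crem_one, crem_two] <;> ring) fun i => by
      rw [coeff_one_crem]
      simp only [h0, h1]
      rw [Fin.prod_univ_three]
      fin_cases i <;> simp [crem_zero, crem_one, crem_two, dcrem] <;> ring
  rw [P.symm.aeval_left] at hdvd
  exact ((isUnit_prod_pow (fun i => by
    rw [h0]; exact mul_ne_zero hc (crem_ne_zero hp i)) ν).dvd_mul_left).mp hdvd

/-- The line `X a = 0` is contracted to `coordPoint a`, its points becoming tangent directions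
there; `v` is the direction belonging to `q`. -/
theorem CremonaPair.singularAlong_of_line (P : CremonaPair d e μ ν F G) {a b c : Fin 3}
    (hab : a ≠ b) (hac : a ≠ c) (hbc : b ≠ c) {q v : Fin 3 → ℂ} (hqa : q a = 0) (hqb : q b ≠ 0)
    (hqc : q c ≠ 0) (hvb : v b = q c) (hvc : v c = q b) (h : 2 ≤ multAt G q) :
    SingularAlong F (coordPoint a) v (μ a) := by
  intro γ t α β ht hα h0 h1
  have hb0 := h0 b
  have hc0 := h0 c
  have ha0 := h0 a
  have hb1 := h1 b
  have hc1 := h1 c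
  simp only [coordPoint, Pi.single_apply, hab.symm, hac.symm, if_false, if_true,
    mul_zero, mul_one, add_zero] at hb0 hc0 ha0 hb1 hc1
  obtain ⟨B, hB⟩ := PowerSeries.X_dvd_iff.mpr hb0
  obtain ⟨E, hE⟩ := PowerSeries.X_dvd_iff.mpr hc0
  rw [hB, ← zero_add 1, PowerSeries.coeff_succ_X_mul,
    PowerSeries.coeff_zero_eq_constantCoeff_apply, hvb] at hb1
  rw [hE, ← zero_add 1, PowerSeries.coeff_succ_X_mul,
    PowerSeries.coeff_zero_eq_constantCoeff_apply, hvc] at hc1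
  -- This is `crem γ` with a factor `X` removed. It passes through a multiple of `q`, and its
  -- coordinate `a` supplies the power `X ^ μ a`.
  set δ : Arc := fun i => if i = a then PowerSeries.X * (B * E) else if i = b then γ a * E
    else γ a * B with hδ
  have hδa : δ a = PowerSeries.X * (B * E) := by simp [hδ]
  have hδb : δ b = γ a * E := by simp [hδ, hab.symm]
  have hδc : δ c = γ a * B := by simp [hδ, hac.symm, hbc.symm]
  have hcrem : crem δ = fun i => (γ a * (B * E)) * γ i := by
    funext i
    rcases eq_or_eq_or_eq hab hac hbc i with rfl | rfl | rfl
    · rw [crem_apply hab hac hbc, hδb, hδc]; ring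
    · rw [crem_apply hab.symm hbc hac, hδa, hδc, hB]; ring
    · rw [crem_apply hac.symm hbc.symm hab, hδa, hδb, hE]; ring
  have hmul : t * α ≠ 0 := mul_ne_zero ht hα
  have h2 := X_pow_dvd_aeval_of_le_multAt P.right_ne
    (h.trans (multAt_smul P.right_ne P.right_hom hmul q).ge) δ fun i => by
      rcases eq_or_eq_or_eq hab hac hbc i with rfl | rfl | rfl
      · simp [hδa, hqa]
      · simp [hδb, ha0, hc1]; ring
      · simp [hδc, ha0, hb1]; ring
  have h3 := P.aeval_left δ
  rw [hcrem, aeval_mul_of_isHomogeneous P.left_hom, prod_eq_of_distinct hab hac hbc, hδa] at h3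
  have hunit : IsUnit ((γ a * (B * E)) ^ d) := by
    refine (isUnit_of_constantCoeff_ne_zero ?_).pow d
    rw [map_mul, map_mul, ha0, hb1, hc1]
    exact mul_ne_zero ht (mul_ne_zero (mul_ne_zero hα hqc) (mul_ne_zero hα hqb))
  rw [← hunit.dvd_mul_left, h3, pow_add]
  refine mul_dvd_mul ?_ h2
  rw [mul_pow, mul_assoc, mul_assoc]
  exact Dvd.intro _ rfl

/-- The passage opposite to `singularAlong_of_line`. Straight arcs transverse to `X a = 0` suffice;
transversality makes the tangent of the transformed arc nonzero modulo `coordPoint a`. -/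
theorem CremonaPair.two_le_multAt (P : CremonaPair d e μ ν F G) {a b c : Fin 3}
    (hab : a ≠ b) (hac : a ≠ c) (hbc : b ≠ c) {q v : Fin 3 → ℂ} (hqa : q a = 0) (hqb : q b = v c)
    (hqc : q c = v b) (hvb : v b ≠ 0) (hvc : v c ≠ 0)
    (h : SingularAlong G (coordPoint a) v (ν a)) : 2 ≤ multAt F q := by
  refine le_multAt_of_generic P.left_ne (X_ne_zero a) fun w hw => ?_
  rw [eval_X] at hw
  set δ := lineArc q w with hδ
  have hδ0 : ∀ i, PowerSeries.constantCoeff (δ i) = q i := fun i => by simp [hδ, lineArc]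
  have hδ1 : PowerSeries.coeff 1 (δ a) = w a := by
    rw [hδ, lineArc, hqa, map_zero, zero_add, ← zero_add 1, PowerSeries.coeff_succ_X_mul]
    simp
  have hdvd := h (crem δ) (v b * v c) (w a) (PowerSeries.coeff 1 (crem δ a) - w a * v a)
    (mul_ne_zero hvb hvc) hw (fun i => by
      rcases eq_or_eq_or_eq hab hac hbc i with rfl | rfl | rfl
      · rw [crem_apply hab hac hbc, map_mul, hδ0, hδ0, hqb, hqc, coordPoint, Pi.single_eq_same]
        ring
      · rw [crem_apply hab.symm hbc hac, map_mul, hδ0, hδ0, hqa, coordPoint,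
          Pi.single_eq_of_ne hab.symm]
        ring
      · rw [crem_apply hac.symm hbc.symm hab, map_mul, hδ0, hδ0, hqa, coordPoint,
          Pi.single_eq_of_ne hac.symm]
        ring) fun i => by
      rcases eq_or_eq_or_eq hab hac hbc i with rfl | rfl | rfl
      · rw [coordPoint, Pi.single_eq_same]
        ring
      · rw [crem_apply hab.symm hbc hac, coeff_one_mul, hδ0, hδ0, hqa, coordPoint,
          Pi.single_eq_of_ne hab.symm, hδ1, hqc]
        ring
      · rw [crem_apply hac.symm hbc.symm hab, coeff_one_mul, hδ0, hδ0, hqa, coordPoint,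
          Pi.single_eq_of_ne hac.symm, hδ1, hqb]
        ring
  have hδa : δ a = PowerSeries.X * algebraMap ℂ _ (w a) := by
    rw [hδ, lineArc, hqa, map_zero, zero_add]
  rw [P.symm.aeval_left, prod_eq_of_distinct hab hac hbc, hδa, mul_pow, pow_add, mul_assoc,
    mul_assoc, mul_assoc, mul_dvd_mul_iff_left (pow_ne_zero _ PowerSeries.X_ne_zero), ← mul_assoc,
    ← mul_assoc] at hdvd
  refine (IsUnit.dvd_mul_left ?_).mp hdvd
  refine isUnit_of_constantCoeff_ne_zero ?_
  rw [map_mul, map_mul, map_pow, map_pow, map_pow, hδ0, hδ0, hqb, hqc]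
  refine mul_ne_zero (mul_ne_zero (pow_ne_zero _ ?_) (pow_ne_zero _ hvc)) (pow_ne_zero _ hvb)
  simpa using hw

/-- On the blowup of the coordinate points, the exceptional curves and the coordinate lines form a
hexagon. Its vertex on the exceptional curve over `coordPoint a` and the line `X c = 0` corresponds
to the vertex on the line `X a = 0` and the exceptional curve over `coordPoint c`. -/
theorem CremonaPair.singularAlong_corner (P : CremonaPair d e μ ν F G) {a b c : Fin 3}
    (hab : a ≠ b) (hac : a ≠ c) (hbc : b ≠ c) {v : Fin 3 → ℂ} (hvb : v b ≠ 0) (hvc : v c = 0)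
    (h : SingularAlong G (coordPoint a) v (ν a)) :
    SingularAlong F (coordPoint c) (coordPoint b) (μ c) := by
  refine singularAlong_of_generic P.left_ne P.left_hom (P.left_mult c).ge a ?_
  intro δ t α β ht hα h0 h1 h2
  have ha0 := h0 a
  have hb0 := h0 b
  have hc0 := h0 c
  have ha1 := h1 a
  have hb1 := h1 b
  simp only [coordPoint, Pi.single_apply, hab, hac, hbc, if_false, if_true,
    mul_zero, mul_one, add_zero] at hb0 hc0 ha0 hb1 ha1
  obtain ⟨B, hB⟩ := PowerSeries.X_dvd_iff.mpr hb0
  -- Thanks to `singularAlong_of_generic`, `δ a` has order exactly two; thus `E` is a unit and `γ`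
  -- below has a definite tangent.
  obtain ⟨E, hE⟩ := X_sq_dvd_iff.mpr ⟨ha0, ha1⟩
  rw [hB, ← zero_add 1, PowerSeries.coeff_succ_X_mul,
    PowerSeries.coeff_zero_eq_constantCoeff_apply] at hb1
  have hE0 : PowerSeries.constantCoeff E ≠ 0 := by
    rw [hE, PowerSeries.coeff_X_pow_mul'] at h2
    simpa using h2
  set γ : Arc := fun i => if i = a then B * δ c else if i = b then PowerSeries.X * (E * δ c)
    else PowerSeries.X ^ 2 * (E * B) with hγ
  have hγa : γ a = B * δ c := by simp [hγ]
  have hγb : γ b = PowerSeries.X * (E * δ c) := by simp [hγ, hab.symm]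
  have hγc : γ c = PowerSeries.X ^ 2 * (E * B) := by simp [hγ, hac.symm, hbc.symm]
  have hcrem : crem δ = fun i => PowerSeries.X * γ i := by
    funext i
    rcases eq_or_eq_or_eq hab hac hbc i with rfl | rfl | rfl
    · rw [crem_apply hab hac hbc, hγa, hB]; ring
    · rw [crem_apply hab.symm hbc hac, hγb, hE]; ring
    · rw [crem_apply hac.symm hbc.symm hab, hγc, hE, hB]; ring
  have hdvd := h γ (α * t) (PowerSeries.constantCoeff E * t / v b)
    (PowerSeries.coeff 1 (γ a) - PowerSeries.constantCoeff E * t / v b * v a)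
    (mul_ne_zero hα ht) (div_ne_zero (mul_ne_zero hE0 ht) hvb) (fun i => by
      rcases eq_or_eq_or_eq hab hac hbc i with rfl | rfl | rfl
      · rw [hγa, map_mul, hb1, hc0, coordPoint, Pi.single_eq_same]; ring
      · rw [hγb, coordPoint, Pi.single_eq_of_ne hab.symm]; simp
      · rw [hγc, coordPoint, Pi.single_eq_of_ne hac.symm]; simp) fun i => by
      rcases eq_or_eq_or_eq hab hac hbc i with rfl | rfl | rfl
      · rw [coordPoint, Pi.single_eq_same]; ring
      · rw [hγb, coordPoint, Pi.single_eq_of_ne hab.symm, ← zero_add 1,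
          PowerSeries.coeff_succ_X_mul, PowerSeries.coeff_zero_eq_constantCoeff_apply, map_mul, hc0]
        field_simp
        ring
      · rw [hγc, coordPoint, Pi.single_eq_of_ne hac.symm, PowerSeries.coeff_X_pow_mul', hvc]
        simp
  have h3 := P.symm.aeval_left δ
  rw [hcrem, aeval_mul_of_isHomogeneous P.right_hom, prod_eq_of_distinct hab hac hbc] at h3
  have h4 : PowerSeries.X ^ e * PowerSeries.X ^ (ν a + 2) ∣
      δ a ^ ν a * δ b ^ ν b * δ c ^ ν c * aeval δ F := by
    rw [← h3]; exact mul_dvd_mul_left _ hdvd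
  have h5 : (PowerSeries.X : PowerSeries ℂ) ^ e * PowerSeries.X ^ (ν a + 2) =
      PowerSeries.X ^ (2 * ν a + ν b) * PowerSeries.X ^ (μ c + 2) := by
    rw [← P.right_sum c a b hac.symm hbc.symm hab]
    ring
  have h6 : δ a ^ ν a * δ b ^ ν b * δ c ^ ν c * aeval δ F = PowerSeries.X ^ (2 * ν a + ν b) *
      (E ^ ν a * B ^ ν b * δ c ^ ν c * aeval δ F) := by
    rw [hE, hB]
    ring
  rw [h5, h6, mul_dvd_mul_iff_left (pow_ne_zero _ PowerSeries.X_ne_zero)] at h4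
  refine (IsUnit.dvd_mul_left ?_).mp h4
  refine isUnit_of_constantCoeff_ne_zero ?_
  rw [map_mul, map_mul, map_pow, map_pow, map_pow, hc0, hb1]
  exact mul_ne_zero (mul_ne_zero (pow_ne_zero _ hE0) (pow_ne_zero _ hα)) (pow_ne_zero _ ht)

end Transport

/-! ### Rationality -/

/-- The field of rational functions generated by the ratios of the coordinates. -/
abbrev ratioField (x : Fin 3 → RatFunc ℂ) : IntermediateField ℂ (RatFunc ℂ) :=
  IntermediateField.adjoin ℂ (Set.range fun ij : Fin 3 × Fin 3 => x ij.1 / x ij.2)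

theorem ratio_mem (x : Fin 3 → RatFunc ℂ) (i j : Fin 3) : x i / x j ∈ ratioField x :=
  IntermediateField.subset_adjoin _ _ ⟨(i, j), rfl⟩

theorem ratioField_ne_top_of_constant {x : Fin 3 → RatFunc ℂ} (t : RatFunc ℂ) (z : Fin 3 → ℂ)
    (h : ∀ i, x i = t * algebraMap ℂ _ (z i)) : ratioField x ≠ ⊤ := by
  intro htop
  have hle : ratioField x ≤ ⊥ := by
    refine IntermediateField.adjoin_le_iff.mpr ?_
    rintro _ ⟨⟨i, j⟩, rfl⟩
    by_cases ht : t = 0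
    · simp [h, ht]
    · simp only [h, mul_div_mul_left _ _ ht]
      rw [← map_div₀]
      exact IntermediateField.algebraMap_mem _ _
  rw [htop] at hle
  have hX : (RatFunc.X : RatFunc ℂ) ∈ (⊥ : IntermediateField ℂ (RatFunc ℂ)) := hle trivial
  obtain ⟨z, hz⟩ := IntermediateField.mem_bot.mp hX
  have : (Polynomial.C z : Polynomial ℂ) = Polynomial.X := by
    apply RatFunc.algebraMap_injective ℂ
    rw [RatFunc.algebraMap_X, ← hz, RatFunc.algebraMap_C]
    rfl
  exact Polynomial.X_ne_C z this.symm

/-- On the line `X a = 0` the form restricts to a nonzero binary form, whose zeros over `RatFunc ℂ`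
are already defined over the algebraically closed field `ℂ`. A point there would have constant
ratios, which cannot generate the whole field. -/
theorem ne_zero_of_ratioField_eq_top {F : Form} {d : ℕ} (hd : F.IsHomogeneous d) {a : Fin 3}
    (hX : ¬ X a ∣ F) {x : Fin 3 → RatFunc ℂ} (hx : aeval x F = 0) (htop : ratioField x = ⊤) :
    x a ≠ 0 := by
  intro hxa
  obtain ⟨b, c, hab, hac, hbc⟩ : ∃ b c : Fin 3, a ≠ b ∧ a ≠ c ∧ b ≠ c := by
    clear hX hxa; revert a; decide
  by_cases hxc : x c = 0
  · refine ratioField_ne_top_of_constant (x b) (Pi.single b 1) (fun i => ?_) htop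
    rcases eq_or_eq_or_eq hab hac hbc i with rfl | rfl | rfl
    · simp [hxa, hab]
    · simp
    · simp [hxc, hbc.symm]
  set f : Polynomial ℂ := aeval (fun i => if i = a then 0 else if i = b then Polynomial.X else 1) F
    with hf
  have hroot : Polynomial.aeval (x b / x c) f = 0 := by
    have h1 : x = fun i => x c * (if i = a then 0 else if i = b then x b / x c else 1) := by
      funext i
      rcases eq_or_eq_or_eq hab hac hbc i with rfl | rfl | rfl
      · simp [hxa]
      · simp [hab.symm]; field_simp
      · simp [hac.symm, hbc.symm]
    rw [h1, aeval_mul_of_isHomogeneous hd] at hx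
    have h2 := (mul_eq_zero.mp hx).resolve_left (pow_ne_zero _ hxc)
    rw [hf, ← AlgHom.comp_apply, comp_aeval, ← h2]
    congr 2
    funext i
    split_ifs <;> simp
  obtain ⟨m, hm, hma⟩ := exists_mem_support_of_not_X_dvd hX
  have hfne : f ≠ 0 := by
    intro h0
    have h1 := congrArg (Polynomial.coeff · (m b)) h0
    simp only [hf, aeval_eq_sum, Polynomial.coeff_zero, Polynomial.finsetSum_coeff] at h1
    rw [Finset.sum_eq_single m] at h1
    · rw [prod_eq_of_distinct hab hac hbc] at h1
      simp only [if_true, hma, pow_zero, one_mul, hab.symm, if_false, hac.symm, hbc.symm, one_pow,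
        mul_one, Polynomial.algebraMap_apply, Algebra.algebraMap_self, RingHom.id_apply,
        Polynomial.coeff_C_mul, Polynomial.coeff_X_pow] at h1
      exact mem_support_iff.mp hm h1
    · intro n hn hnm
      rw [prod_eq_of_distinct hab hac hbc]
      simp only [if_true, hab.symm, if_false, hac.symm, hbc.symm, one_pow,
        mul_one, Polynomial.algebraMap_apply, Algebra.algebraMap_self, RingHom.id_apply,
        Polynomial.coeff_C_mul]
      by_cases hna : n a = 0
      · rw [hna, pow_zero, one_mul, Polynomial.coeff_X_pow, if_neg, mul_zero]
        intro hb
        apply hnm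
        have e1 := degree_eq_of_mem_support hd hn
        have e2 := degree_eq_of_mem_support hd hm
        rw [sum_eq_of_distinct hab hac hbc] at e1 e2
        ext i
        rcases eq_or_eq_or_eq hab hac hbc i with rfl | rfl | rfl <;> omega
      · rw [zero_pow hna, zero_mul, Polynomial.coeff_zero, mul_zero]
    · intro h; exact absurd hm h
  have halg : IsIntegral ℂ (x b / x c) := IsAlgebraic.isIntegral ⟨f, hfne, hroot⟩
  obtain ⟨z, hz⟩ := minpoly.mem_range_of_degree_eq_one ℂ (x b / x c)
    (IsAlgClosed.degree_eq_one_of_irreducible ℂ (minpoly.irreducible halg))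
  refine ratioField_ne_top_of_constant (x c) (fun i => if i = a then 0 else if i = b then z else 1)
    (fun i => ?_) htop
  rcases eq_or_eq_or_eq hab hac hbc i with rfl | rfl | rfl
  · simp [hxa]
  · simp only [hab.symm, if_false, if_true, hz]; field_simp
  · simp [hac.symm, hbc.symm]

/-- The transformation inverts the ratios of the coordinates, so they generate the same field. -/
theorem CremonaPair.isRationalCurve {d e : ℕ} {μ ν : Fin 3 → ℕ} {F G : Form}
    (P : CremonaPair d e μ ν F G) (h : IsRationalCurve F) : IsRationalCurve G := by
  obtain ⟨x, hx, htop⟩ := h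
  have hne : ∀ a, x a ≠ 0 := fun a => ne_zero_of_ratioField_eq_top P.left_hom (P.left_not_dvd a) hx
    htop
  refine ⟨crem x, by rw [P.symm.aeval_left, hx, mul_zero], ?_⟩
  rw [← htop]
  congr 1
  have hswap : ∀ i j, crem x i / crem x j = x j / x i := fun i j => by
    have h1 : ∀ k, x k * crem x k = ∏ l, x l := fun k =>
      Finset.mul_prod_erase _ _ (Finset.mem_univ k)
    rw [div_eq_div_iff (crem_ne_zero hne j) (hne i), mul_comm, h1, h1]
  ext y
  constructor
  · rintro ⟨⟨i, j⟩, rfl⟩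
    exact ⟨(j, i), (hswap i j).symm⟩
  · rintro ⟨⟨i, j⟩, rfl⟩
    exact ⟨(j, i), hswap j i⟩

theorem isRationalCurve_substLin {g h : Matrix (Fin 3) (Fin 3) ℂ} (hgh : g * h = 1)
    {F : Form} (hF : IsRationalCurve F) : IsRationalCurve (substLin g F) := by
  obtain ⟨x, hx, htop⟩ := hF
  refine ⟨act h x, by rw [aeval_substLin, act_act, hgh, act_one, hx], ?_⟩
  rw [← top_le_iff, ← htop]
  refine IntermediateField.adjoin_le_iff.mpr ?_
  rintro _ ⟨⟨i, j⟩, rfl⟩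
  set y := act h x with hy
  have hxy : x = act g y := by rw [hy, act_act, hgh, act_one]
  change x i / x j ∈ ratioField y
  by_cases h0 : ∃ r, y r ≠ 0
  · obtain ⟨r, hr⟩ := h0
    have hdiv : ∀ k, x k / y r ∈ ratioField y := fun k => by
      rw [hxy, act, Finset.sum_div]
      refine sum_mem fun l _ => ?_
      rw [mul_div_assoc]
      exact mul_mem (IntermediateField.algebraMap_mem _ _) (ratio_mem y l r)
    rw [← div_div_div_cancel_right₀ hr]
    exact div_mem (hdiv i) (hdiv j)
  · push Not at h0
    have : x i = 0 := by rw [hxy]; simp [act, h0]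
    rw [this, zero_div]
    exact zero_mem _

/-! ### Curves with prescribed multiplicities -/

/-- `F = 0` is an irreducible curve of degree `d` whose multiplicities at the points with homogeneous
coordinates `a i` are `μ i`. -/
structure IrreducibleCurve {N : ℕ} (d : ℕ) (μ : Fin N → ℕ) (a : Fin N → Fin 3 → ℂ) (F : Form) :
    Prop where
  homogeneous : F.IsHomogeneous d
  irreducible : Irreducible F
  mult : ∀ i, multAt F (a i) = μ i

/-- `F = 0` is rational and its proper transform on the blowup at the points `a i`, where it has
multiplicities `μ i`, is smooth. -/
structure SmoothRational {N : ℕ} (μ : Fin N → ℕ) (a : Fin N → Fin 3 → ℂ) (F : Form) :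
    Prop where
  rational : IsRationalCurve F
  away : ∀ q, q ≠ 0 → (∀ i (c : ℂ), q ≠ c • a i) → multAt F q ≤ 1
  exceptional : ∀ i v, (∀ c : ℂ, v ≠ c • a i) → ¬ SingularAlong F (a i) v (μ i)

section Linear

variable {N d : ℕ} {μ : Fin N → ℕ} {a b : Fin N → Fin 3 → ℂ} {F : Form}
  {g h : Matrix (Fin 3) (Fin 3) ℂ}

theorem IrreducibleCurve.substLin (hF : IrreducibleCurve d μ a F) (hgh : g * h = 1)
    (hhg : h * g = 1) (hb : ∀ l, ∃ s : ℂ, s ≠ 0 ∧ act g (b l) = s • a l) :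
    IrreducibleCurve d μ b (substLin g F) where
  homogeneous := isHomogeneous_substLin g hF.homogeneous
  irreducible := irreducible_substLin hgh hhg hF.irreducible
  mult i := by
    obtain ⟨s, hs, h1⟩ := hb i
    rw [multAt_substLin hgh hhg hF.irreducible.ne_zero, h1,
      multAt_smul hF.irreducible.ne_zero hF.homogeneous hs, hF.mult]

theorem eq_smul_of_act_eq_smul (hhg : h * g = 1) {s : ℂ} (hs : s ≠ 0) {p q r : Fin 3 → ℂ}
    (hp : act g p = s • r) {c : ℂ} (hq : act g q = c • r) : q = (c / s) • p := by
  have h1 : r = s⁻¹ • act g p := by rw [hp, smul_smul, inv_mul_cancel₀ hs, one_smul]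
  rw [h1, smul_smul, ← act_smul] at hq
  have := congrArg (act h) hq
  rwa [act_act, act_act, hhg, act_one, act_one] at this

theorem SmoothRational.substLin (hS : SmoothRational μ a F) (hF : IrreducibleCurve d μ a F)
    (hgh : g * h = 1)
    (hhg : h * g = 1) (hb : ∀ l, ∃ s : ℂ, s ≠ 0 ∧ act g (b l) = s • a l) :
    SmoothRational μ b (substLin g F) where
  rational := isRationalCurve_substLin hgh hS.rational
  away q hq hqb := by
    rw [multAt_substLin hgh hhg hF.irreducible.ne_zero]
    refine hS.away _ (fun h0 => hq ?_) fun i c hc => ?_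
    · have := congrArg (act h) h0
      rw [act_act, hhg, act_one] at this
      rw [this]
      funext i
      simp [act]
    · obtain ⟨s, hs, h1⟩ := hb i
      exact hqb i _ (eq_smul_of_act_eq_smul hhg hs h1 hc)
  exceptional i v hv hsing := by
    obtain ⟨s, hs, h1⟩ := hb i
    have h2 := hsing.of_substLin hgh hhg
    rw [h1] at h2
    exact hS.exceptional i _ (fun c hc => hv _ (eq_smul_of_act_eq_smul hhg hs h1 hc))
      (h2.of_smul hs)

end Linear

theorem not_X_dvd_of_irreducible {F : Form} {d : ℕ} (hd : F.IsHomogeneous d) (h2 : 2 ≤ d)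
    (hF : Irreducible F) (a : Fin 3) : ¬ X a ∣ F := by
  intro hdvd
  have hassoc : Associated (X a) F := (X_prime (i := a)).irreducible.associated_of_dvd hF hdvd
  obtain ⟨u, hu⟩ := hassoc
  obtain ⟨r, hr, hur⟩ := isUnit_iff_eq_C_of_isReduced.mp u.isUnit
  have h1 : F.IsHomogeneous 1 := by
    rw [← hu, hur, mul_comm]
    exact isHomogeneous_C_mul_X _ _
  have := hd.inj_right h1 hF.ne_zero
  omega

/-- The classes `(d; μ)` and `(e; ν)` correspond to each other under the quadratic transformation
based at the three points with indices `f`. -/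
structure CremonaClass {N : ℕ} (f : Fin 3 → Fin N) (d : ℕ) (μ : Fin N → ℕ) (e : ℕ)
    (ν : Fin N → ℕ) : Prop where
  degree : e + ∑ c, μ (f c) = 2 * d
  base : ∀ a b c : Fin 3, a ≠ b → a ≠ c → b ≠ c → ν (f a) + μ (f b) + μ (f c) = d
  other : ∀ l, (∀ c, f c ≠ l) → ν l = μ l

/-- The points `b` are in normal position: the points with indices `f` are the coordinate points,
and the others are not on the coordinate lines. -/
structure NormalPosition {N : ℕ} (f : Fin 3 → Fin N) (b : Fin N → Fin 3 → ℂ) : Prop where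
  base : ∀ c, b (f c) = coordPoint c
  other : ∀ l, (∀ c, f c ≠ l) → ∀ i, b l i ≠ 0

open Classical in
/-- The images of points in normal position under the quadratic transformation. -/
def cremPoints {N : ℕ} (f : Fin 3 → Fin N) (b : Fin N → Fin 3 → ℂ) : Fin N → Fin 3 → ℂ :=
  fun l => if ∃ c, f c = l then b l else crem (b l)

/-! ### Transforming curves whose base points are the coordinate points -/

section Normal

variable {N d e : ℕ} {f : Fin 3 → Fin N} {μ ν : Fin N → ℕ} {b : Fin N → Fin 3 → ℂ} {F : Form}

theorem cremPoints_base (hb : NormalPosition f b) (c : Fin 3) :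
    cremPoints f b (f c) = coordPoint c := by
  unfold cremPoints
  rw [if_pos ⟨c, rfl⟩, hb.base]

theorem cremPoints_other {l : Fin N} (hl : ∀ c, f c ≠ l) : cremPoints f b l = crem (b l) := by
  unfold cremPoints
  rw [if_neg (by push Not; exact hl)]

theorem NormalPosition.cremPoints (hb : NormalPosition f b) :
    NormalPosition f (cremPoints f b) where
  base := cremPoints_base hb
  other l hl i := by
    rw [cremPoints_other hl]
    exact crem_ne_zero (hb.other l hl) i

theorem coordPoint_ne_smul {a b : Fin 3} (hab : a ≠ b) {v : Fin 3 → ℂ} (hv : v b ≠ 0) (c : ℂ) :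
    v ≠ c • coordPoint a := by
  intro h
  apply hv
  rw [h, Pi.smul_apply, coordPoint, Pi.single_eq_of_ne hab.symm, smul_zero]

theorem eq_smul_coordPoint {a b c : Fin 3} (hab : a ≠ b) (hac : a ≠ c) (hbc : b ≠ c)
    {v : Fin 3 → ℂ} (hb : v b = 0) (hc : v c = 0) : v = v a • coordPoint a := by
  funext i
  rcases eq_or_eq_or_eq hab hac hbc i with rfl | rfl | rfl
  · simp [coordPoint]
  · simp [coordPoint, hb, hab.symm]
  · simp [coordPoint, hc, hac.symm]

theorem smul_crem_eq {p q : Fin 3 → ℂ} (hq : ∀ i, q i ≠ 0) {c : ℂ} (h : crem q = c • p) :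
    q = (c ^ 2 / ∏ i, q i) • crem p := by
  have hprod : ∏ i, q i ≠ 0 := Finset.prod_ne_zero_iff.mpr fun i _ => hq i
  have h1 : crem (crem q) = c ^ 2 • crem p := by
    rw [h]
    funext i
    fin_cases i <;> simp [crem_zero, crem_one, crem_two] <;> ring
  rw [crem_crem] at h1
  funext i
  have h2 := congrFun h1 i
  simp only [Pi.smul_apply, smul_eq_mul] at h2 ⊢
  field_simp
  linear_combination h2

/-- Each possible singularity of the new proper transform is traced back to one of the old: points
and directions off the coordinate lines to the same, points of a coordinate line to directions at
the opposite vertex and conversely, corners to corners. -/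
theorem SmoothRational.cremona {G : Form} (hb : NormalPosition f b)
    (P : CremonaPair d e (fun c => μ (f c)) (fun c => ν (f c)) F G) (hC : CremonaClass f d μ e ν)
    (hS : SmoothRational μ b F) : SmoothRational ν (cremPoints f b) G where
  rational := P.isRationalCurve hS.rational
  away q hq hqb := by
    by_cases htorus : ∀ i, q i ≠ 0
    · rw [P.multAt_eq htorus]
      have hcq : ∀ i, crem q i ≠ 0 := crem_ne_zero htorus
      refine hS.away _ (fun h0 => hcq 0 (by rw [h0]; rfl)) fun l c hc => ?_
      by_cases hl : ∀ x, f x ≠ l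
      · refine hqb l (c ^ 2 / ∏ i, q i) ?_
        rw [cremPoints_other hl]
        exact smul_crem_eq htorus hc
      · push Not at hl
        obtain ⟨x, rfl⟩ := hl
        rw [hb.base] at hc
        obtain ⟨y, hxy⟩ : ∃ y : Fin 3, x ≠ y := by clear hc; revert x; decide
        exact coordPoint_ne_smul hxy (hcq y) c hc
    · push Not at htorus
      obtain ⟨a, hqa⟩ := htorus
      obtain ⟨b', c', hab, hac, hbc⟩ : ∃ b c : Fin 3, a ≠ b ∧ a ≠ c ∧ b ≠ c := by
        clear hqa; revert a; decide
      -- The vertices are among the blown-up points, so `q` lies on only one coordinate line.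
      have hqb' : q b' ≠ 0 := fun h0 => hqb (f c') (q c') (by
        rw [cremPoints_base hb]
        exact eq_smul_coordPoint hac.symm hbc.symm hab hqa h0)
      have hqc' : q c' ≠ 0 := fun h0 => hqb (f b') (q b') (by
        rw [cremPoints_base hb]
        exact eq_smul_coordPoint hab.symm hbc hac hqa h0)
      by_contra hlt
      have hsing := P.singularAlong_of_line (v := fun i => if i = b' then q c' else q b')
        hab hac hbc hqa hqb' hqc' (by simp) (by simp [hbc.symm]) (by omega)
      rw [← hb.base] at hsing
      refine hS.exceptional (f a) _ ?_ hsing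
      rw [hb.base]
      exact coordPoint_ne_smul hab (by simpa using hqc')
  exceptional i v hv hsing := by
    by_cases hi : ∀ x, f x ≠ i
    · rw [cremPoints_other hi] at hsing hv
      have hbi := hb.other i hi
      have hcb := crem_ne_zero hbi
      rw [hC.other i hi] at hsing
      have h1 := P.singularAlong_torus hcb hsing
      rw [crem_crem] at h1
      have hprod : ∏ j, b i j ≠ 0 := Finset.prod_ne_zero_iff.mpr fun j _ => hbi j
      refine hS.exceptional i _ (fun c hc => ?_) (SingularAlong.of_smul hprod h1)
      refine hv _ (eq_smul_of_dcrem_eq_smul hcb (c := c / ∏ j, b i j) ?_)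
      rw [hc, crem_crem]
      funext j
      simp only [Pi.smul_apply, smul_eq_mul]
      field_simp
    · push Not at hi
      obtain ⟨a, rfl⟩ := hi
      rw [cremPoints_base hb] at hsing hv
      obtain ⟨b', c', hab, hac, hbc⟩ : ∃ b c : Fin 3, a ≠ b ∧ a ≠ c ∧ b ≠ c := by
        clear hv hsing; revert a; decide
      -- A direction with exactly one of these two entries zero points along a coordinate line.
      have hcorner : ∀ {b' c' : Fin 3}, a ≠ b' → a ≠ c' → b' ≠ c' → v b' ≠ 0 → v c' ≠ 0 := by
        intro b' c' hab hac hbc hvb hvc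
        have h1 := P.singularAlong_corner hab hac hbc hvb hvc hsing
        rw [← hb.base c'] at h1
        refine hS.exceptional (f c') _ ?_ h1
        rw [hb.base]
        exact coordPoint_ne_smul hbc.symm (by simp [coordPoint])
      by_cases hvb : v b' = 0
      · by_cases hvc : v c' = 0
        · exact hv _ (eq_smul_coordPoint hab hac hbc hvb hvc)
        · exact hcorner hac hab hbc.symm hvc hvb
      · have hvc := hcorner hab hac hbc hvb
        -- The point of `X a = 0` that belongs to the direction `v`.
        set q : Fin 3 → ℂ := fun i => if i = a then 0 else if i = b' then v c' else v b' with hq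
        have hqa : q a = 0 := by simp [hq]
        have hqb : q b' = v c' := by simp [hq, hab.symm]
        have hqc : q c' = v b' := by simp [hq, hac.symm, hbc.symm]
        have h2 := P.two_le_multAt hab hac hbc hqa hqb hqc hvb hvc hsing
        have h3 : multAt F q ≤ 1 := by
          refine hS.away q (fun h0 => hvc (by rw [← hqb, h0]; rfl)) fun l c hc => ?_
          by_cases hl : ∀ x, f x ≠ l
          · have h4 := congrFun hc a
            rw [hqa, Pi.smul_apply, smul_eq_mul, eq_comm, mul_eq_zero] at h4
            have h5 := h4.resolve_right (hb.other l hl a)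
            rw [h5, zero_smul] at hc
            exact hvc (by rw [← hqb, hc]; rfl)
          · push Not at hl
            obtain ⟨x, rfl⟩ := hl
            rw [hb.base] at hc
            by_cases hx : x = b'
            · subst hx
              exact coordPoint_ne_smul hbc (by rwa [hqc]) c hc
            · exact coordPoint_ne_smul hx (by rwa [hqb]) c hc
        omega

theorem exists_cremona (hb : NormalPosition f b)
    (hC : CremonaClass f d μ e ν) (h2 : 2 ≤ d ∨ ∀ a, ¬ X a ∣ F) (hF : IrreducibleCurve d μ b F) :
    ∃ G, IrreducibleCurve e ν (cremPoints f b) G ∧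
      (SmoothRational μ b F → SmoothRational ν (cremPoints f b) G) := by
  have hX : ∀ a, ¬ X a ∣ F := by
    rcases h2 with h2 | h2
    · exact not_X_dvd_of_irreducible hF.homogeneous h2 hF.irreducible
    · exact h2
  obtain ⟨G, P⟩ := exists_cremonaPair (e := e) (μ := fun c => μ (f c)) (ν := fun c => ν (f c))
    hF.homogeneous hX (fun a => by rw [← hb.base, hF.mult]) hC.base hC.degree
  refine ⟨G, ⟨P.right_hom, P.irreducible hF.irreducible, fun l => ?_⟩, fun hS => hS.cremona hb P hC⟩
  by_cases hl : ∀ x, f x ≠ l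
  · rw [cremPoints_other hl, hC.other l hl, ← P.symm.multAt_eq (hb.other l hl), hF.mult]
  · push Not at hl
    obtain ⟨x, rfl⟩ := hl
    rw [cremPoints_base hb, P.right_mult]

end Normal

/-- The points `a` and `a'` correspond to each other under a quadratic transformation based at the
points with indices `f`. -/
def CremonaRel {N : ℕ} (f : Fin 3 → Fin N) (a a' : Fin N → Fin 3 → ℂ) : Prop :=
  ∃ (g h g' h' : Matrix (Fin 3) (Fin 3) ℂ) (b : Fin N → Fin 3 → ℂ),
    g * h = 1 ∧ h * g = 1 ∧ g' * h' = 1 ∧ h' * g' = 1 ∧ NormalPosition f b ∧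
    (∀ l, ∃ s : ℂ, s ≠ 0 ∧ act g (b l) = s • a l) ∧
    ∀ l, ∃ s : ℂ, s ≠ 0 ∧ act g' (cremPoints f b l) = s • a' l

theorem CremonaRel.symm {N : ℕ} {f : Fin 3 → Fin N} {a a' : Fin N → Fin 3 → ℂ}
    (hR : CremonaRel f a a') : CremonaRel f a' a := by
  obtain ⟨g, h, g', h', b, hgh, hhg, hgh', hhg', hb, ha, ha'⟩ := hR
  refine ⟨g', h', g, h, cremPoints f b, hgh', hhg', hgh, hhg, hb.cremPoints, ha', fun l => ?_⟩
  obtain ⟨s, hs, h1⟩ := ha l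
  by_cases hl : ∀ x, f x ≠ l
  · have hprod : ∏ i, b l i ≠ 0 := Finset.prod_ne_zero_iff.mpr fun i _ => hb.other l hl i
    refine ⟨(∏ i, b l i) * s, mul_ne_zero hprod hs, ?_⟩
    rw [cremPoints_other hl, cremPoints_other hl, crem_crem, mul_smul, ← h1]
    exact act_smul _ _ _
  · push Not at hl
    obtain ⟨x, rfl⟩ := hl
    refine ⟨s, hs, ?_⟩
    rw [cremPoints_base hb.cremPoints, ← hb.base, h1]

theorem CremonaRel.exists_curve {N : ℕ} {f : Fin 3 → Fin N} {a a' : Fin N → Fin 3 → ℂ}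
    (hR : CremonaRel f a a') {d e : ℕ} {μ ν : Fin N → ℕ} (hC : CremonaClass f d μ e ν) {F : Form}
    (hF : IrreducibleCurve d μ a F) :
    ∃ G, IrreducibleCurve e ν a' G ∧ (SmoothRational μ a F → SmoothRational ν a' G) := by
  obtain ⟨g, h, g', h', b, hgh, hhg, hgh', hhg', hb, ha, ha'⟩ := hR
  have hF1 := hF.substLin hgh hhg ha
  -- In degree one, irreducibility does not exclude a coordinate line. But a curve containing such a
  -- line passes through two base points, and `hsum` then gives `2 ≤ d`.
  have hX : 2 ≤ d ∨ ∀ a, ¬ X a ∣ substLin g F := by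
    by_cases h2 : 2 ≤ d
    · exact Or.inl h2
    right
    rintro a ⟨H, hH⟩
    obtain ⟨b', c', hab, hac, hbc⟩ : ∃ b c : Fin 3, a ≠ b ∧ a ≠ c ∧ b ≠ c := by
      clear hH; revert a; decide
    have hsum := hC.base a b' c' hab hac hbc
    have hone : ∀ x, a ≠ x → 1 ≤ μ (f x) := fun x hx => by
      rw [← hF1.mult, hb.base, le_multAt_coordPoint_iff hF1.irreducible.ne_zero hF1.homogeneous]
      intro m hm
      have h3 := degree_eq_of_mem_support hF1.homogeneous hm
      have h4 : m a ≠ 0 := fun h0 => not_X_dvd_of_mem_support hm h0 ⟨H, hH⟩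
      have h5 : m a + m x ≤ ∑ i, m i := by
        rw [← Finset.sum_pair hx]
        exact Finset.sum_le_sum_of_subset (Finset.subset_univ _)
      omega
    have := hone b' hab
    have := hone c' hac
    omega
  obtain ⟨G, hG, hGS⟩ := exists_cremona hb hC hX hF1
  have hback : ∀ l, ∃ s : ℂ, s ≠ 0 ∧ act h' (a' l) = s • cremPoints f b l := fun l => by
    obtain ⟨s, hs, h1⟩ := ha' l
    refine ⟨s⁻¹, inv_ne_zero hs, ?_⟩
    have : a' l = s⁻¹ • act g' (cremPoints f b l) := by
      rw [h1, smul_smul, inv_mul_cancel₀ hs, one_smul]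
    rw [this, act_smul, act_act, hhg', act_one]
  exact ⟨substLin h' G, hG.substLin hhg' hgh' hback, fun hS =>
    (hGS (hS.substLin hF hgh hhg ha)).substLin hG hhg' hgh' hback⟩

/-! ### General points -/

section Generic

variable {N : ℕ}

/-- Polynomial functions of `N` vectors. -/
def IsPoly (φ : (Fin N → Fin 3 → ℂ) → ℂ) : Prop :=
  ∃ Φ : MvPolynomial (Fin N × Fin 3) ℂ, ∀ a, eval (fun ij => a ij.1 ij.2) Φ = φ a

theorem isPoly_const (r : ℂ) : IsPoly fun _ : Fin N → Fin 3 → ℂ => r := ⟨C r, fun _ => by simp⟩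

theorem isPoly_coord (l : Fin N) (i : Fin 3) : IsPoly fun a : Fin N → Fin 3 → ℂ => a l i :=
  ⟨X (l, i), fun _ => by simp⟩

theorem IsPoly.mul {φ ψ : (Fin N → Fin 3 → ℂ) → ℂ} (hφ : IsPoly φ) (hψ : IsPoly ψ) :
    IsPoly fun a => φ a * ψ a := by
  obtain ⟨Φ, hΦ⟩ := hφ
  obtain ⟨Ψ, hΨ⟩ := hψ
  exact ⟨Φ * Ψ, fun a => by rw [map_mul, hΦ, hΨ]⟩

theorem IsPoly.sub {φ ψ : (Fin N → Fin 3 → ℂ) → ℂ} (hφ : IsPoly φ) (hψ : IsPoly ψ) :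
    IsPoly fun a => φ a - ψ a := by
  obtain ⟨Φ, hΦ⟩ := hφ
  obtain ⟨Ψ, hΨ⟩ := hψ
  exact ⟨Φ - Ψ, fun a => by rw [map_sub, hΦ, hΨ]⟩

theorem isPoly_sum {ι : Type*} (s : Finset ι) {φ : ι → (Fin N → Fin 3 → ℂ) → ℂ}
    (hφ : ∀ i ∈ s, IsPoly (φ i)) : IsPoly fun a => ∑ i ∈ s, φ i a := by
  choose! Φ hΦ using hφ
  exact ⟨∑ i ∈ s, Φ i, fun a => by
    rw [map_sum]; exact Finset.sum_congr rfl fun i hi => hΦ i hi a⟩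

theorem isPoly_prod {ι : Type*} (s : Finset ι) {φ : ι → (Fin N → Fin 3 → ℂ) → ℂ}
    (hφ : ∀ i ∈ s, IsPoly (φ i)) : IsPoly fun a => ∏ i ∈ s, φ i a := by
  choose! Φ hΦ using hφ
  exact ⟨∏ i ∈ s, Φ i, fun a => by
    rw [map_prod]; exact Finset.prod_congr rfl fun i hi => hΦ i hi a⟩

theorem IsPoly.comp {φ : (Fin N → Fin 3 → ℂ) → ℂ} (hφ : IsPoly φ)
    {α : (Fin N → Fin 3 → ℂ) → Fin N → Fin 3 → ℂ} (hα : ∀ l i, IsPoly fun a => α a l i) :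
    IsPoly fun a => φ (α a) := by
  obtain ⟨Φ, hΦ⟩ := hφ
  choose A hA using hα
  refine ⟨aeval (fun ij => A ij.1 ij.2) Φ, fun a => ?_⟩
  change _ = φ (α a)
  rw [← hΦ, ← coe_aeval_eq_eval, ← coe_aeval_eq_eval]
  simp only [RingHom.coe_coe]
  rw [← AlgHom.comp_apply, comp_aeval]
  congr 2
  funext ij
  have h := hA ij.1 ij.2 a
  rwa [← coe_aeval_eq_eval] at h

theorem isPoly_det {M : (Fin N → Fin 3 → ℂ) → Matrix (Fin 3) (Fin 3) ℂ}
    (hM : ∀ i j, IsPoly fun a => M a i j) : IsPoly fun a => (M a).det := by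
  simp only [Matrix.det_apply']
  exact isPoly_sum _ fun σ _ => (isPoly_const _).mul (isPoly_prod _ fun i _ => hM _ _)

theorem isPoly_adjugate {M : (Fin N → Fin 3 → ℂ) → Matrix (Fin 3) (Fin 3) ℂ}
    (hM : ∀ i j, IsPoly fun a => M a i j) (i j : Fin 3) : IsPoly fun a => (M a).adjugate i j := by
  simp only [Matrix.adjugate_apply]
  refine isPoly_det fun k l => ?_
  simp only [Matrix.updateRow_apply]
  split_ifs
  · exact isPoly_const _
  · exact hM k l

theorem isPoly_act {M : (Fin N → Fin 3 → ℂ) → Matrix (Fin 3) (Fin 3) ℂ}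
    (hM : ∀ i j, IsPoly fun a => M a i j) {v : (Fin N → Fin 3 → ℂ) → Fin 3 → ℂ}
    (hv : ∀ i, IsPoly fun a => v a i) (i : Fin 3) : IsPoly fun a => act (M a) (v a) i :=
  isPoly_sum _ fun j _ => (hM i j).mul (hv j)

theorem exists_mul_ne_zero {φ ψ : (Fin N → Fin 3 → ℂ) → ℂ} (hφ : IsPoly φ) (hψ : IsPoly ψ)
    (h1 : ∃ a, φ a ≠ 0) (h2 : ∃ a, ψ a ≠ 0) : ∃ a, φ a * ψ a ≠ 0 := by
  obtain ⟨Φ, hΦ⟩ := hφ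
  obtain ⟨Ψ, hΨ⟩ := hψ
  obtain ⟨a, ha⟩ := h1
  obtain ⟨b, hb⟩ := h2
  by_contra hno
  push Not at hno
  have : Φ * Ψ = 0 := by
    refine MvPolynomial.funext fun x => ?_
    have := hno fun i j => x (i, j)
    rw [← hΦ, ← hΨ, ← map_mul] at this
    simpa using this
  rcases mul_eq_zero.mp this with h | h
  · exact ha (by rw [← hΦ, h, map_zero])
  · exact hb (by rw [← hΨ, h, map_zero])

/-- `Q` holds for general `N`-tuples of vectors. -/
def Generic (Q : (Fin N → Fin 3 → ℂ) → Prop) : Prop :=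
  ∃ φ : (Fin N → Fin 3 → ℂ) → ℂ, IsPoly φ ∧ (∃ a, φ a ≠ 0) ∧ ∀ a, φ a ≠ 0 → Q a

theorem Generic.mono {Q R : (Fin N → Fin 3 → ℂ) → Prop} (h : Generic Q) (hQR : ∀ a, Q a → R a) :
    Generic R := by
  obtain ⟨φ, h1, h2, h3⟩ := h
  exact ⟨φ, h1, h2, fun a ha => hQR a (h3 a ha)⟩

theorem Generic.and {Q R : (Fin N → Fin 3 → ℂ) → Prop} (hQ : Generic Q) (hR : Generic R) :
    Generic fun a => Q a ∧ R a := by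
  obtain ⟨φ, h1, h2, h3⟩ := hQ
  obtain ⟨ψ, k1, k2, k3⟩ := hR
  exact ⟨_, h1.mul k1, exists_mul_ne_zero h1 k1 h2 k2, fun a ha =>
    ⟨h3 a (left_ne_zero_of_mul ha), k3 a (right_ne_zero_of_mul ha)⟩⟩

theorem generic_forall {ι : Type*} [Fintype ι] {Q : ι → (Fin N → Fin 3 → ℂ) → Prop}
    (h : ∀ i, Generic (Q i)) : Generic fun a => ∀ i, Q i a := by
  classical
  have : ∀ s : Finset ι, Generic fun a => ∀ i ∈ s, Q i a := by
    intro s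
    induction s using Finset.induction_on with
    | empty => exact ⟨_, isPoly_const 1, ⟨0, one_ne_zero⟩, by simp⟩
    | insert i s _ ih =>
      refine ((h i).and ih).mono fun a ha j hj => ?_
      rcases Finset.mem_insert.mp hj with rfl | hj
      · exact ha.1
      · exact ha.2 j hj
  exact (this Finset.univ).mono fun a ha i => ha i (Finset.mem_univ i)

/-- The matrix whose columns are the vectors with indices `f`. -/
def frame (f : Fin 3 → Fin N) (a : Fin N → Fin 3 → ℂ) : Matrix (Fin 3) (Fin 3) ℂ :=
  Matrix.of fun i j => a (f j) i

theorem act_coordPoint (g : Matrix (Fin 3) (Fin 3) ℂ) (c : Fin 3) :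
    act g (coordPoint c) = fun i => g i c := by
  funext i
  simp [act, coordPoint, Pi.single_apply]

theorem act_frame (f : Fin 3 → Fin N) (a : Fin N → Fin 3 → ℂ) (c : Fin 3) :
    act (frame f a) (coordPoint c) = a (f c) := by
  rw [act_coordPoint]
  rfl

theorem isPoly_frame (f : Fin 3 → Fin N) (i j : Fin 3) :
    IsPoly fun a : Fin N → Fin 3 → ℂ => frame f a i j := isPoly_coord _ _

theorem frame_eq_one {f : Fin 3 → Fin N} {a : Fin N → Fin 3 → ℂ}
    (ha : ∀ c, a (f c) = coordPoint c) : frame f a = 1 := by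
  ext i j
  simp [frame, ha, coordPoint, Matrix.one_apply, Pi.single_apply]

theorem act_smul_one (c : ℂ) (v : Fin 3 → ℂ) :
    act (c • (1 : Matrix (Fin 3) (Fin 3) ℂ)) v = c • v := by
  funext i
  simp [act, Matrix.one_apply]

theorem exists_inverse {g : Matrix (Fin 3) (Fin 3) ℂ} (hg : g.det ≠ 0) :
    ∃ h, g * h = 1 ∧ h * g = 1 :=
  ⟨g⁻¹, Matrix.mul_nonsing_inv _ (isUnit_iff_ne_zero.mpr hg),
    Matrix.nonsing_inv_mul _ (isUnit_iff_ne_zero.mpr hg)⟩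

/-- The coordinates of the vectors in the frame `f`, up to a common factor. -/
def frameCoord (f : Fin 3 → Fin N) (a : Fin N → Fin 3 → ℂ) (l : Fin N) : Fin 3 → ℂ :=
  act (frame f a).adjugate (a l)

theorem isPoly_frameCoord (f : Fin 3 → Fin N) (l : Fin N) (i : Fin 3) :
    IsPoly fun a : Fin N → Fin 3 → ℂ => frameCoord f a l i :=
  isPoly_act (isPoly_adjugate (isPoly_frame f)) (isPoly_coord l) i

theorem act_frame_frameCoord (f : Fin 3 → Fin N) (a : Fin N → Fin 3 → ℂ) (l : Fin N) :
    act (frame f a) (frameCoord f a l) = (frame f a).det • a l := by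
  rw [frameCoord, act_act, Matrix.mul_adjugate, act_smul_one]

theorem frameCoord_of_normal {f : Fin 3 → Fin N} {a : Fin N → Fin 3 → ℂ}
    (ha : ∀ c, a (f c) = coordPoint c) (l : Fin N) : frameCoord f a l = a l := by
  rw [frameCoord, frame_eq_one ha, Matrix.adjugate_one, act_one]

/-- The three vectors with indices `f` are linearly independent, and no other one is on a plane
spanned by two of them. -/
def InFrame (f : Fin 3 → Fin N) (a : Fin N → Fin 3 → ℂ) : Prop :=
  (frame f a).det ≠ 0 ∧ ∀ l, (∀ c, f c ≠ l) → ∀ i, frameCoord f a l i ≠ 0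

open Classical in
theorem generic_inFrame {f : Fin 3 → Fin N} (hf : Function.Injective f) : Generic (InFrame f) := by
  let a₀ : Fin N → Fin 3 → ℂ := fun l => if h : ∃ c, f c = l then coordPoint h.choose else 1
  have h0 : ∀ c, a₀ (f c) = coordPoint c := fun c => by
    have h : ∃ c', f c' = f c := ⟨c, rfl⟩
    simp only [a₀, dif_pos h]
    rw [hf h.choose_spec]
  have h1 : ∀ l, (∀ c, f c ≠ l) → a₀ l = 1 := fun l hl => by
    simp only [a₀]
    rw [dif_neg (by push Not; exact hl)]
  refine Generic.and ⟨_, isPoly_det (isPoly_frame f), ⟨a₀, ?_⟩, fun a ha => ha⟩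
    (generic_forall fun l => ?_)
  · rw [frame_eq_one h0, Matrix.det_one]
    exact one_ne_zero
  · by_cases hl : ∀ c, f c ≠ l
    · refine (generic_forall fun i => ⟨_, isPoly_frameCoord f l i, ⟨a₀, ?_⟩, fun a ha => ha⟩).mono
        fun a ha _ => ha
      rw [frameCoord_of_normal h0, h1 l hl]
      exact one_ne_zero
    · exact ⟨_, isPoly_const 1, ⟨0, one_ne_zero⟩, fun a _ h => absurd h hl⟩

theorem InFrame.cremonaRel {f : Fin 3 → Fin N} (hf : Function.Injective f)
    {a a₀ : Fin N → Fin 3 → ℂ} (ha : InFrame f a) (ha₀ : (frame f a₀).det ≠ 0)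
    {a' : Fin N → Fin 3 → ℂ} (hbase : ∀ c, a' (f c) = a₀ (f c))
    (hother : ∀ l, (∀ c, f c ≠ l) → a' l = act (frame f a₀) (crem (frameCoord f a l))) :
    CremonaRel f a a' := by
  classical
  obtain ⟨h, hgh, hhg⟩ := exists_inverse ha.1
  obtain ⟨h', hgh', hhg'⟩ := exists_inverse ha₀
  let b : Fin N → Fin 3 → ℂ := fun l =>
    if h : ∃ c, f c = l then coordPoint h.choose else frameCoord f a l
  have h0 : ∀ c, b (f c) = coordPoint c := fun c => by
    have h : ∃ c', f c' = f c := ⟨c, rfl⟩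
    simp only [b, dif_pos h]
    rw [hf h.choose_spec]
  have h1 : ∀ l, (∀ c, f c ≠ l) → b l = frameCoord f a l := fun l hl => by
    simp only [b]
    rw [dif_neg (by push Not; exact hl)]
  have hb : NormalPosition f b := ⟨h0, fun l hl i => by rw [h1 l hl]; exact ha.2 l hl i⟩
  refine ⟨frame f a, h, frame f a₀, h', b, hgh, hhg, hgh', hhg', hb, fun l => ?_, fun l => ?_⟩
  · by_cases hl : ∀ c, f c ≠ l
    · exact ⟨_, ha.1, by rw [h1 l hl, act_frame_frameCoord]⟩
    · push Not at hl
      obtain ⟨c, rfl⟩ := hl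
      exact ⟨1, one_ne_zero, by rw [h0, act_frame, one_smul]⟩
  · by_cases hl : ∀ c, f c ≠ l
    · exact ⟨1, one_ne_zero, by rw [cremPoints_other hl, h1 l hl, hother l hl, one_smul]⟩
    · push Not at hl
      obtain ⟨c, rfl⟩ := hl
      exact ⟨1, one_ne_zero, by rw [cremPoints_base hb, act_frame, one_smul, hbase]⟩

/-- The transformed configuration `α a` is polynomial in `a`, with its base points pinned at those
of a good configuration `a₀`. A generic condition pulls back along `α` once its polynomial is
nonzero somewhere, and `α` hits `a₀` because the transformation is an involution up to scalars. -/
theorem Generic.cremona {f : Fin 3 → Fin N} (hf : Function.Injective f)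
    {Q R : (Fin N → Fin 3 → ℂ) → Prop} (hQ : Generic Q)
    (hQR : ∀ a a', CremonaRel f a a' → Q a' → R a) : Generic R := by
  classical
  obtain ⟨φ, hφ, hφ0, hφQ⟩ := hQ
  obtain ⟨ψ, hψ, hψ0, hψF⟩ := generic_inFrame hf
  obtain ⟨a₀, ha₀⟩ := exists_mul_ne_zero hφ hψ hφ0 hψ0
  have hF₀ : InFrame f a₀ := hψF a₀ (right_ne_zero_of_mul ha₀)
  let α : (Fin N → Fin 3 → ℂ) → Fin N → Fin 3 → ℂ := fun a l =>
    if ∃ c, f c = l then a₀ l else act (frame f a₀) (crem (frameCoord f a l))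
  have hαbase : ∀ a c, α a (f c) = a₀ (f c) := fun a c => if_pos ⟨c, rfl⟩
  have hαother : ∀ a l, (∀ c, f c ≠ l) → α a l = act (frame f a₀) (crem (frameCoord f a l)) :=
    fun a l hl => if_neg (by push Not; exact hl)
  have hα : ∀ l i, IsPoly fun a => α a l i := fun l i => by
    simp only [α]
    split_ifs
    · exact isPoly_const _
    · exact isPoly_act (M := fun _ => frame f a₀) (v := fun a => crem (frameCoord f a l))
        (fun _ _ => isPoly_const _)
        (fun i => isPoly_prod _ fun j _ => isPoly_frameCoord f l j) i
  have hgen : Generic fun a => Q (α a) := by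
    refine ⟨_, hφ.comp hα, ?_, fun a ha => hφQ _ ha⟩
    -- The square roots make `α` hit the vectors of `a₀` themselves, not just their multiples; the
    -- value `0` at base indices is filler.
    have hsq : ∀ l, ∃ t : ℂ, t ^ 2 * ((∏ i, frameCoord f a₀ l i) * (frame f a₀).det) =
        if ∀ c, f c ≠ l then 1 else 0 := fun l => by
      split_ifs with hl
      · have hne : (∏ i, frameCoord f a₀ l i) * (frame f a₀).det ≠ 0 :=
          mul_ne_zero (Finset.prod_ne_zero_iff.mpr fun i _ => hF₀.2 l hl i) hF₀.1
        obtain ⟨t, ht⟩ := IsAlgClosed.exists_pow_nat_eq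
          ((∏ i, frameCoord f a₀ l i) * (frame f a₀).det)⁻¹ (n := 2) (by norm_num)
        exact ⟨t, by rw [ht, inv_mul_cancel₀ hne]⟩
      · exact ⟨0, by simp⟩
    choose t ht using hsq
    let a₁ : Fin N → Fin 3 → ℂ := fun l =>
      if h : ∃ c, f c = l then coordPoint h.choose else t l • crem (frameCoord f a₀ l)
    have h0 : ∀ c, a₁ (f c) = coordPoint c := fun c => by
      have h : ∃ c', f c' = f c := ⟨c, rfl⟩
      simp only [a₁, dif_pos h]
      rw [hf h.choose_spec]
    have h1 : ∀ l, (∀ c, f c ≠ l) → a₁ l = t l • crem (frameCoord f a₀ l) := fun l hl => by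
      simp only [a₁]
      rw [dif_neg (by push Not; exact hl)]
    refine ⟨a₁, ?_⟩
    have : α a₁ = a₀ := by
      funext l
      by_cases hl : ∀ c, f c ≠ l
      · rw [hαother a₁ l hl, frameCoord_of_normal h0, h1 l hl]
        have h2 : crem (t l • crem (frameCoord f a₀ l)) =
            (t l ^ 2 * ∏ i, frameCoord f a₀ l i) • frameCoord f a₀ l := by
          have h3 : crem (t l • crem (frameCoord f a₀ l)) =
              t l ^ 2 • crem (crem (frameCoord f a₀ l)) := by
            funext i
            fin_cases i <;>
              simp only [Fin.zero_eta, Fin.mk_one, Fin.reduceFinMk, crem_zero, crem_one, crem_two,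
                Pi.smul_apply, smul_eq_mul] <;> ring
          rw [h3, crem_crem, mul_smul]
          rfl
        rw [h2, act_smul, act_frame_frameCoord, smul_smul, mul_assoc, ht, if_pos hl, one_smul]
      · push Not at hl
        obtain ⟨c, rfl⟩ := hl
        exact hαbase _ _
    rw [this]
    exact left_ne_zero_of_mul ha₀
  exact (hgen.and (generic_inFrame hf)).mono fun a ha =>
    hQR a _ (ha.2.cremonaRel hf hF₀.1 (hαbase a) (hαother a)) ha.1

end Generic

/-! ### Lines -/

theorem multAt_X_le_one (p : Fin 3 → ℂ) : multAt (X 0) p ≤ 1 := by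
  by_contra h
  have h1 := X_pow_dvd_aeval_of_le_multAt (X_ne_zero 0) (show 2 ≤ multAt (X 0) p by omega)
    (lineArc p 1) fun i => by simp [lineArc]
  rw [aeval_X, X_sq_dvd_iff] at h1
  have h2 := h1.2
  rw [lineArc, map_add, ← zero_add 1, PowerSeries.coeff_succ_X_mul] at h2
  simp [PowerSeries.coeff_succ_C] at h2

theorem multAt_X_eq_zero {p : Fin 3 → ℂ} (hp : p 0 ≠ 0) : multAt (X 0) p = 0 := by
  by_contra h
  have h1 := X_pow_dvd_aeval_of_le_multAt (X_ne_zero 0) (show 1 ≤ multAt (X 0) p by omega)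
    (lineArc p 0) fun i => by simp [lineArc]
  rw [aeval_X, pow_one, PowerSeries.X_dvd_iff] at h1
  simp [lineArc] at h1
  exact hp h1

theorem multAt_X_eq_one {p : Fin 3 → ℂ} (hp : p 0 = 0) : multAt (X 0) p = 1 := by
  refine le_antisymm (multAt_X_le_one p) ?_
  refine le_multAt_of_forall_arc (X_ne_zero 0) fun γ hγ => ?_
  rw [aeval_X, pow_one, PowerSeries.X_dvd_iff, hγ, hp]

theorem isRationalCurve_X : IsRationalCurve (X 0) := by
  refine ⟨![0, RatFunc.X, 1], by simp, ?_⟩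
  rw [← top_le_iff, ← RatFunc.adjoin_X]
  refine IntermediateField.adjoin.mono _ _ _ ?_
  rw [Set.singleton_subset_iff]
  exact ⟨(1, 2), by simp⟩

theorem not_singularAlong_X {p v : Fin 3 → ℂ} {k : ℕ} (hk : multAt (X 0) p = k) :
    ¬ SingularAlong (X 0) p v k := by
  intro h
  -- The quadratic term bounds the order of the coordinate by two, whatever `v` is.
  have h1 := h (fun i => PowerSeries.C (p i) + PowerSeries.X *
    (PowerSeries.C (v i) + PowerSeries.X)) 1 1 0 one_ne_zero one_ne_zero (fun i => by simp)
    fun i => by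
      rw [map_add, ← zero_add 1, PowerSeries.coeff_succ_X_mul]
      simp [PowerSeries.coeff_succ_C]
  rw [aeval_X, PowerSeries.X_pow_dvd_iff] at h1
  by_cases hp : p 0 = 0
  · rw [multAt_X_eq_one hp] at hk
    have h2 := h1 (1 + 1) (by omega)
    rw [map_add, PowerSeries.coeff_succ_X_mul, map_add, PowerSeries.coeff_one_X,
      PowerSeries.coeff_succ_C, ← zero_add 1, PowerSeries.coeff_succ_C] at h2
    simp at h2
  · have h2 := h1 0 (by omega)
    simp at h2
    exact hp h2

/-- For general points there is a curve of class `(d; μ)` that is irreducible and rational and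
has a smooth proper transform. -/
def GoodClass {N : ℕ} (d : ℕ) (μ : Fin N → ℕ) : Prop :=
  Generic fun a => ∃ F, IrreducibleCurve d μ a F ∧ SmoothRational μ a F

/-- In the frame `coordPoint 0, a i, a j` the line is `X 0 = 0`; the remaining points avoid it when
their coordinate `0` is nonzero, and the adjugate makes this a polynomial condition. -/
theorem goodClass_line {N : ℕ} {i j : Fin N} (hij : i ≠ j) :
    GoodClass 1 (fun l => if l = i ∨ l = j then 1 else 0) := by
  let M : (Fin N → Fin 3 → ℂ) → Matrix (Fin 3) (Fin 3) ℂ := fun a =>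
    Matrix.of fun k c => (![coordPoint 0, a i, a j] c) k
  have hM : ∀ k c, IsPoly fun a => M a k c := fun k c => by
    fin_cases c
    · exact isPoly_const _
    · exact isPoly_coord i k
    · exact isPoly_coord j k
  let a₀ : Fin N → Fin 3 → ℂ := fun l =>
    if l = i then coordPoint 1 else if l = j then coordPoint 2 else coordPoint 0
  have hM₀ : M a₀ = 1 := by
    ext k c
    fin_cases c <;> simp [M, a₀, hij.symm, coordPoint, Matrix.one_apply, Pi.single_apply]
  have hgen : Generic fun a => (M a).det ≠ 0 ∧
      ∀ l, l ≠ i ∧ l ≠ j → act (M a).adjugate (a l) 0 ≠ 0 := by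
    refine Generic.and ⟨_, isPoly_det hM, ⟨a₀, by rw [hM₀]; simp⟩, fun a ha => ha⟩
      (generic_forall fun l => ?_)
    by_cases hl : l ≠ i ∧ l ≠ j
    · refine ⟨_, isPoly_act (isPoly_adjugate hM) (isPoly_coord l) 0, ⟨a₀, ?_⟩, fun a ha _ => ha⟩
      rw [hM₀, Matrix.adjugate_one, act_one]
      simp [a₀, hl.1, hl.2, coordPoint]
    · exact ⟨_, isPoly_const 1, ⟨0, one_ne_zero⟩, fun a _ h => absurd h hl⟩
  refine hgen.mono fun a ha => ?_
  obtain ⟨hdet, hother⟩ := ha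
  obtain ⟨h, hgh, hhg⟩ := exists_inverse hdet
  have hi : act h (a i) = coordPoint 1 := by
    have : a i = act (M a) (coordPoint 1) := by rw [act_coordPoint]; rfl
    rw [this, act_act, hhg, act_one]
  have hj : act h (a j) = coordPoint 2 := by
    have : a j = act (M a) (coordPoint 2) := by rw [act_coordPoint]; rfl
    rw [this, act_act, hhg, act_one]
  have hl : ∀ l, l ≠ i ∧ l ≠ j → act h (a l) 0 ≠ 0 := fun l hl h0 => by
    apply hother l hl
    have : (M a).adjugate = (M a).det • h := by
      rw [← Matrix.mul_one (M a).adjugate, ← hgh, ← Matrix.mul_assoc, Matrix.adjugate_mul,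
        Matrix.smul_mul, Matrix.one_mul]
    rw [this]
    have h2 : act ((M a).det • h) (a l) = (M a).det • act h (a l) := by
      funext k
      simp [act, Finset.mul_sum, mul_assoc]
    rw [h2, Pi.smul_apply, h0, smul_zero]
  have hmult : ∀ l, multAt (X 0) (act h (a l)) = if l = i ∨ l = j then 1 else 0 := fun l => by
    split_ifs with h1
    · refine multAt_X_eq_one ?_
      rcases h1 with rfl | rfl
      · rw [hi]; simp [coordPoint]
      · rw [hj]; simp [coordPoint]
    · exact multAt_X_eq_zero (hl l (by tauto))
  have hirr : IrreducibleCurve 1 (fun l => if l = i ∨ l = j then 1 else 0)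
      (fun l => act h (a l)) (X 0) :=
    ⟨isHomogeneous_X _ _, (X_prime (i := 0)).irreducible, hmult⟩
  have hsm : SmoothRational (fun l => if l = i ∨ l = j then 1 else 0)
      (fun l => act h (a l)) (X 0) :=
    ⟨isRationalCurve_X, fun q _ _ => multAt_X_le_one q,
      fun l v _ => not_singularAlong_X (hmult l)⟩
  have hb : ∀ l, ∃ s : ℂ, s ≠ 0 ∧ act h (a l) = s • act h (a l) := fun l =>
    ⟨1, one_ne_zero, (one_smul _ _).symm⟩
  exact ⟨_, hirr.substLin hhg hgh hb, hsm.substLin hirr hhg hgh hb⟩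

/-! ### Classes -/

section Classes

variable {N : ℕ}

theorem GoodClass.cremona {d e : ℕ} {μ ν : Fin N → ℕ} (h : GoodClass d μ) {f : Fin 3 → Fin N}
    (hf : Function.Injective f) (hC : CremonaClass f d μ e ν) : GoodClass e ν := by
  refine Generic.cremona hf h fun a a' hR hF => ?_
  obtain ⟨F, hF, hS⟩ := hF
  obtain ⟨G, hG, hGS⟩ := hR.symm.exists_curve hC hF
  exact ⟨G, hG, hGS hS⟩

theorem generic_not_exists_cremona {d e : ℕ} {μ ν : Fin N → ℕ}
    (h : Generic fun a => ¬ ∃ F, IrreducibleCurve e ν a F) {f : Fin 3 → Fin N}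
    (hf : Function.Injective f) (hC : CremonaClass f d μ e ν) :
    Generic fun a => ¬ ∃ F, IrreducibleCurve d μ a F := by
  refine Generic.cremona hf h fun a a' hR hno hF => hno ?_
  obtain ⟨F, hF⟩ := hF
  obtain ⟨G, hG, -⟩ := hR.exists_curve hC hF
  exact ⟨G, hG⟩

theorem injective_triple {i j k : Fin N} (hij : i ≠ j) (hik : i ≠ k) (hjk : j ≠ k) :
    Function.Injective ![i, j, k] := by
  intro x y h
  fin_cases x <;> fin_cases y <;> simp_all

theorem cremonaClass_triple {i j k : Fin N} {d e : ℕ} {μ ν : Fin N → ℕ}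
    (hdeg : e + (μ i + μ j + μ k) = 2 * d) (hi : ν i + μ j + μ k = d) (hj : ν j + μ i + μ k = d)
    (hk : ν k + μ i + μ j = d) (hother : ∀ l, l ≠ i → l ≠ j → l ≠ k → ν l = μ l) :
    CremonaClass ![i, j, k] d μ e ν where
  degree := by simpa [Fin.sum_univ_three] using hdeg
  base a b c hab hac hbc := by
    fin_cases a <;> fin_cases b <;> fin_cases c <;> simp at hab hac hbc ⊢ <;> omega
  other l hl := hother l (hl 0).symm (hl 1).symm (hl 2).symm

/-- Curves of degree `d + 1` with a point of multiplicity `d`. -/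
theorem goodClass_monoid (d : ℕ) (p : Fin N) (T : Finset (Fin N)) (hp : p ∉ T)
    (hT : T.card = 2 * d + 2) :
    GoodClass (d + 1) (fun l => if l = p then d else if l ∈ T then 1 else 0) := by
  classical
  induction d generalizing T with
  | zero =>
    obtain ⟨i, j, hij, rfl⟩ := Finset.card_eq_two.mp hT
    convert! goodClass_line hij using 2 with l
    by_cases h1 : l = p
    · subst h1
      simp at hp
      simp [hp]
    · simp [h1]
  | succ d ih =>
    obtain ⟨i, hi⟩ : T.Nonempty := Finset.card_pos.mp (by omega)
    obtain ⟨j, hj⟩ : (T.erase i).Nonempty :=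
      Finset.card_pos.mp (by rw [Finset.card_erase_of_mem hi]; omega)
    have hji : j ≠ i := Finset.ne_of_mem_erase hj
    have hjT : j ∈ T := Finset.mem_of_mem_erase hj
    have hip : i ≠ p := by rintro rfl; exact hp hi
    have hjp : j ≠ p := by rintro rfl; exact hp hjT
    have h1 := ih ((T.erase i).erase j) (by simp [hp])
      (by rw [Finset.card_erase_of_mem hj, Finset.card_erase_of_mem hi]; omega)
    -- Based at `p` and two points of multiplicity zero: (d + 1; d, 0, 0) becomes (d + 2; d + 1, 1,
    -- 1).
    refine h1.cremona (injective_triple hip.symm hjp.symm hji.symm) (cremonaClass_triple ?_ ?_ ?_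
      ?_ fun l h2 h3 h4 => ?_)
    · simp [hip, hjp]; omega
    · simp [hip, hjp]
    · simp [hip, hjp, hi]; omega
    · simp [hip, hjp, hjT]; omega
    · simp [h2, h3, h4]

/-- Start from a curve of degree `q + 2` with an `(q + 1)`-fold point `r`, simple along `T` and
missing `p`. Each transformation at `p` and two simple points of `T` adds `q` to the degree and to
the three multiplicities involved; `k` counts these transformations. -/
theorem goodClass_deJonquieres (q k : ℕ) (p r : Fin N) (S T : Finset (Fin N)) (hpr : p ≠ r)
    (hp : p ∉ T) (hr : r ∉ T) (hST : S ⊆ T) (hT : T.card = 2 * q + 4) (hS : S.card = 2 * k) :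
    GoodClass (q + 2 + k * q) (fun l => if l = p then k * q else if l = r ∨ l ∈ S then q + 1
      else if l ∈ T then 1 else 0) := by
  classical
  induction k generalizing S with
  | zero =>
    obtain rfl : S = ∅ := Finset.card_eq_zero.mp (by simpa using hS)
    rw [show q + 2 + 0 * q = q + 1 + 1 by ring]
    convert! goodClass_monoid (q + 1) r T hr (by rw [hT]; ring) using 2 with l
    by_cases h1 : l = p
    · subst h1
      simp [hpr, hp]
    · simp [h1]
  | succ k ih =>
    obtain ⟨i, hi⟩ : S.Nonempty := Finset.card_pos.mp (by omega)
    obtain ⟨j, hj⟩ : (S.erase i).Nonempty :=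
      Finset.card_pos.mp (by rw [Finset.card_erase_of_mem hi]; omega)
    have hji : j ≠ i := Finset.ne_of_mem_erase hj
    have hjS : j ∈ S := Finset.mem_of_mem_erase hj
    have hip : i ≠ p := by rintro rfl; exact hp (hST hi)
    have hjp : j ≠ p := by rintro rfl; exact hp (hST hjS)
    have hir : i ≠ r := by rintro rfl; exact hr (hST hi)
    have hjr : j ≠ r := by rintro rfl; exact hr (hST hjS)
    have hiT := hST hi
    have hjT := hST hjS
    have h1 := ih ((S.erase i).erase j)
      (((Finset.erase_subset _ _).trans (Finset.erase_subset _ _)).trans hST)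
      (by rw [Finset.card_erase_of_mem hj, Finset.card_erase_of_mem hi]; omega)
    refine h1.cremona (injective_triple hip.symm hjp.symm hji.symm) (cremonaClass_triple ?_ ?_ ?_
      ?_ fun l h2 h3 h4 => ?_)
    · simp [hip, hjp, hir, hjr, hiT, hjT]; ring
    · simp [hip, hjp, hir, hjr, hiT, hjT]; ring
    · simp [hip, hjp, hir, hjr, hi, hjT]; ring
    · simp [hip, hjp, hir, hjr, hiT, hjS]; ring
    · simp [h2, h3, h4]

/-- A curve of degree at least two cannot have too large multiplicities at two points. -/
theorem generic_not_exists_of_lt {d : ℕ} {μ : Fin N → ℕ} {f : Fin 3 → Fin N}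
    (hf : Function.Injective f) (hd : 2 ≤ d) (hμ : d < μ (f 1) + μ (f 2)) :
    Generic fun a => ¬ ∃ F, IrreducibleCurve d μ a F := by
  refine (generic_inFrame hf).mono fun a ha hF => ?_
  obtain ⟨F, hF⟩ := hF
  obtain ⟨h, hgh, hhg⟩ := exists_inverse ha.1
  have hne := hF.irreducible.ne_zero
  have hm : ∀ c, multAt (substLin (frame f a) F) (coordPoint c) = μ (f c) := fun c => by
    rw [multAt_substLin hgh hhg hne, act_frame, hF.mult]
  refine not_X_dvd_of_irreducible (isHomogeneous_substLin _ hF.homogeneous) hd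
    (irreducible_substLin hgh hhg hF.irreducible) 0
    (X_dvd_of_lt_multAt_add_multAt (substLin_ne_zero hgh hne)
      (isHomogeneous_substLin _ hF.homogeneous) (b := 1) (c := 2) (by decide) (by decide)
      (by decide) ?_)
  rw [hm, hm]
  exact hμ

/-- Transforming at the largest multiplicities lowers the degree through 27, 23, 19, 15, 9, 7, 5.
The chain is written backwards from degree 5, where two triple points exceed the degree. -/
theorem generic_not_exists_irreducibleCurve : Generic fun a : Fin 10 → Fin 3 → ℂ =>
    ¬ ∃ F, IrreducibleCurve 27 ![17, 7, 7, 7, 7, 7, 7, 7, 7, 7] a F := by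
  have h6 : Generic fun a : Fin 10 → Fin 3 → ℂ =>
      ¬ ∃ F, IrreducibleCurve 5 ![3, 1, 1, 1, 1, 1, 3, 1, 1, 1] a F :=
    generic_not_exists_of_lt (f := ![1, 0, 6]) (by decide) (by decide) (by decide)
  have h5 := generic_not_exists_cremona (d := 7) (μ := ![3, 1, 1, 3, 3, 3, 3, 1, 1, 1]) h6
    (f := ![3, 4, 5]) (by decide) ⟨by decide, by decide, by decide⟩
  have h4 := generic_not_exists_cremona (d := 9) (μ := ![5, 3, 3, 3, 3, 3, 3, 1, 1, 1]) h5
    (f := ![0, 1, 2]) (by decide) ⟨by decide, by decide, by decide⟩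
  have h3 := generic_not_exists_cremona (d := 15) (μ := ![5, 3, 3, 3, 3, 3, 3, 7, 7, 7]) h4
    (f := ![7, 8, 9]) (by decide) ⟨by decide, by decide, by decide⟩
  have h2 := generic_not_exists_cremona (d := 19) (μ := ![9, 3, 3, 3, 3, 7, 7, 7, 7, 7]) h3
    (f := ![0, 5, 6]) (by decide) ⟨by decide, by decide, by decide⟩
  have h1 := generic_not_exists_cremona (d := 23) (μ := ![13, 3, 3, 7, 7, 7, 7, 7, 7, 7]) h2
    (f := ![0, 3, 4]) (by decide) ⟨by decide, by decide, by decide⟩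
  exact generic_not_exists_cremona h1 (f := ![0, 1, 2]) (by decide)
    ⟨by decide, by decide, by decide⟩

end Classes

/-! ### Curves on the blowup at general points -/

theorem smoothAt_of_multAt_le_one {F : Form} (hF : F ≠ 0) {q : Fin 3 → ℂ} (h : multAt F q ≤ 1) :
    SmoothAt F q := by
  intro h0
  by_contra hno
  push Not at hno
  have h2 : 2 ≤ multAt F q := by
    refine le_multAt_of_forall_arc hF fun γ hγ => ?_
    rw [X_sq_dvd_iff, constantCoeff_aeval, coeff_one_aeval, funext hγ]
    exact ⟨h0, Finset.sum_eq_zero fun j _ => by rw [hno, zero_mul]⟩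
  omega

section Points

variable {N : ℕ}

theorem exists_rep_eq_smul (v : Fin 3 → ℂ) (hv : v ≠ 0) :
    ∃ s : ℂ, s ≠ 0 ∧ (Projectivization.mk ℂ v hv).rep = s • v := by
  obtain ⟨s, hs⟩ := Projectivization.exists_smul_eq_mk_rep ℂ v hv
  exact ⟨s, s.ne_zero, hs.symm⟩

theorem projectivization_eq_of_rep_eq_smul {P Q : Plane} {c : ℂ} (h : Q.rep = c • P.rep) :
    Q = P := by
  rw [← Q.mk_rep, ← P.mk_rep]
  exact (Projectivization.mk_eq_mk_iff' ℂ _ _ _ _).mpr ⟨c, h.symm⟩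

theorem Generic.forGeneralPoints {Q : (Fin N → Fin 3 → ℂ) → Prop} (hQ : Generic Q)
    {R : (Fin N → Plane) → Prop}
    (h : ∀ (a : Fin N → Fin 3 → ℂ) (ha : ∀ i, a i ≠ 0), Q a →
      R fun i => Projectivization.mk ℂ (a i) (ha i)) : ForGeneralPoints R := by
  obtain ⟨φ, ⟨Φ, hΦ⟩, ⟨b, hb⟩, hφ⟩ := hQ
  refine ⟨Φ, ?_, fun a ha h0 => h a ha (hφ a (by rwa [← hΦ]))⟩
  rintro rfl
  rw [← hΦ, map_zero] at hb
  exact hb rfl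

theorem generic_not_parallel : Generic fun a : Fin N → Fin 3 → ℂ =>
    ∀ i j, i ≠ j → ∀ c : ℂ, a i ≠ c • a j := by
  refine generic_forall fun i => generic_forall fun j => ?_
  by_cases hij : i = j
  · exact ⟨_, isPoly_const 1, ⟨0, one_ne_zero⟩, fun a _ h => absurd hij h⟩
  · refine ⟨_, ((isPoly_coord i 0).mul (isPoly_coord j 1)).sub
      ((isPoly_coord i 1).mul (isPoly_coord j 0)),
      ⟨fun l => if l = i then coordPoint 0 else coordPoint 1, ?_⟩, fun a ha _ c hc => ha ?_⟩
    · simp [Ne.symm hij, coordPoint]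
    · rw [hc]
      simp only [Pi.smul_apply, smul_eq_mul]
      ring

theorem isMinusOneCurve_of_smoothRational {d : ℕ} {μ : Fin N → ℕ} (hμ : selfIntersection d μ = -1)
    {P : Fin N → Plane} (hP : Function.Injective P) {F : Form}
    (hF : IrreducibleCurve d μ (fun i => (P i).rep) F)
    (hS : SmoothRational μ (fun i => (P i).rep) F) : IsMinusOneCurve P d F where
  distinct := hP
  homogeneous := hF.homogeneous
  irreducible := hF.irreducible
  rational := hS.rational
  smooth :=
    { away := fun q hq => smoothAt_of_multAt_le_one hF.irreducible.ne_zero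
        (hS.away _ q.rep_nonzero fun i _ hc => hq i (projectivization_eq_of_rep_eq_smul hc))
      exceptional := fun i v w hli u => by
        by_contra hno
        have h1 := singularAlong_of_not_smoothAt hF.irreducible.ne_zero hF.homogeneous hli hno
        rw [hF.mult i] at h1
        refine hS.exceptional i _ (fun c hc => ?_) h1
        have h2 := Fintype.linearIndependent_iff.mp hli ![-c, 1, u] (by
          rw [Fin.sum_univ_three]
          simp only [Matrix.cons_val_zero, Matrix.cons_val_one, Matrix.cons_val, neg_smul,
            one_smul]
          rw [add_assoc, hc, neg_add_cancel]) 1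
        simp at h2 }
  self_intersection := by
    rw [show (fun i => multAt F (P i).rep) = μ from funext hF.mult, hμ]

theorem GoodClass.forGeneralPoints {d : ℕ} {μ : Fin N → ℕ} (h : GoodClass d μ)
    (hμ : selfIntersection d μ = -1) :
    ForGeneralPoints fun P : Fin N → Plane => ∃ F, IsMember d μ P F ∧ IsMinusOneCurve P d F := by
  refine (Generic.and h generic_not_parallel).forGeneralPoints fun a ha hQ => ?_
  obtain ⟨⟨F, hF, hS⟩, hpar⟩ := hQ
  have hb : ∀ l, ∃ s : ℂ, s ≠ 0 ∧
      act 1 (Projectivization.mk ℂ (a l) (ha l)).rep = s • a l := fun l => by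
    rw [act_one]
    exact exists_rep_eq_smul _ _
  -- The identity substitution only changes the representatives of the points.
  have hF' := hF.substLin (mul_one 1) (mul_one 1) hb
  have hS' := hS.substLin hF (mul_one 1) (mul_one 1) hb
  refine ⟨_, ⟨hF'.irreducible.ne_zero, hF'.homogeneous, fun i => (hF'.mult i).ge⟩,
    isMinusOneCurve_of_smoothRational hμ (fun i j hij => ?_) hF' hS'⟩
  by_contra hne
  obtain ⟨c, hc⟩ := (Projectivization.mk_eq_mk_iff' ℂ _ _ _ _).mp hij
  exact hpar i j hne c hc.symm

theorem not_and_of_forGeneralPoints {Q : (Fin N → Plane) → Prop} (h1 : ForGeneralPoints Q)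
    (h2 : ForGeneralPoints fun P => ¬ Q P) : False := by
  obtain ⟨Φ, hΦ, h1⟩ := h1
  obtain ⟨Ψ, hΨ, h2⟩ := h2
  -- The extra factor keeps every vector nonzero, so that it represents a point.
  have hne : Φ * Ψ * ∏ i : Fin N, X (i, (0 : Fin 3)) ≠ 0 :=
    mul_ne_zero (mul_ne_zero hΦ hΨ) (Finset.prod_ne_zero_iff.mpr fun i _ => X_ne_zero _)
  obtain ⟨x, hx⟩ : ∃ x, eval x (Φ * Ψ * ∏ i : Fin N, X (i, (0 : Fin 3))) ≠ 0 := by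
    by_contra hno
    push Not at hno
    exact hne (MvPolynomial.funext fun x => by rw [hno, map_zero])
  rw [map_mul, map_mul, map_prod] at hx
  have ha : ∀ i : Fin N, (fun k => x (i, k)) ≠ (0 : Fin 3 → ℂ) := fun i h0 => by
    have h3 := Finset.prod_ne_zero_iff.mp (right_ne_zero_of_mul hx) i (Finset.mem_univ i)
    rw [eval_X] at h3
    exact h3 (congrFun h0 0)
  have hx' := left_ne_zero_of_mul hx
  exact h2 (fun i k => x (i, k)) ha (right_ne_zero_of_mul hx')
    (h1 (fun i k => x (i, k)) ha (left_ne_zero_of_mul hx'))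

end Points

/-! ### Quasi-homogeneous classes -/

theorem selfIntersection_qhMult (d m₀ n m : ℕ) :
    selfIntersection d (qhMult m₀ n m) = (d : ℤ) ^ 2 - (m₀ : ℤ) ^ 2 - n * (m : ℤ) ^ 2 := by
  simp [selfIntersection, qhMult, Fin.sum_univ_succ]
  ring

theorem arithmeticGenus_qhMult (d m₀ n m : ℕ) :
    arithmeticGenus d (qhMult m₀ n m) = ((d : ℚ) * (d - 3) - m₀ * (m₀ - 1) -
      n * (m * (m - 1))) / 2 + 1 := by
  simp [arithmeticGenus, qhMult, Fin.sum_univ_succ]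
  ring

/-- By adjunction, 2g - 2 = L² + K·L, so the genus condition becomes -K·L = 1. -/
theorem isQHMinusOneClass_iff (d m₀ n m : ℕ) : IsQHMinusOneClass d m₀ n m ↔
    (d : ℤ) ^ 2 - (m₀ : ℤ) ^ 2 - n * (m : ℤ) ^ 2 = -1 ∧ 3 * (d : ℤ) - m₀ - n * m = 1 := by
  unfold IsQHMinusOneClass
  rw [selfIntersection_qhMult, arithmeticGenus_qhMult]
  constructor
  · rintro ⟨h1, h2⟩
    refine ⟨h1, ?_⟩
    have h1' : (d : ℚ) ^ 2 - (m₀ : ℚ) ^ 2 - n * (m : ℚ) ^ 2 = -1 := by exact_mod_cast h1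
    have h3 : 3 * (d : ℚ) - m₀ - n * m = 1 := by linear_combination h1' - 2 * h2
    exact_mod_cast h3
  · rintro ⟨h1, h2⟩
    refine ⟨h1, ?_⟩
    have h1' : (d : ℚ) ^ 2 - (m₀ : ℚ) ^ 2 - n * (m : ℚ) ^ 2 = -1 := by exact_mod_cast h1
    have h2' : 3 * (d : ℚ) - m₀ - n * m = 1 := by exact_mod_cast h2
    linear_combination (h1' - h2') / 2

theorem isIrreducibleMinusOneClass_of_goodClass {d m₀ n m : ℕ} (h : IsQHMinusOneClass d m₀ n m)
    (hg : GoodClass d (qhMult m₀ n m)) : IsIrreducibleMinusOneClass d m₀ n m :=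
  ⟨h, hg.forGeneralPoints h.1⟩

theorem goodClass_qh_monoid (d : ℕ) : GoodClass (d + 1) (qhMult d (2 * d + 2) 1) := by
  convert! goodClass_monoid d (0 : Fin (2 * d + 2 + 1)) {0}ᶜ (by simp)
    (by rw [Finset.card_compl]; simp) using 2 with l
  refine Fin.cases ?_ (fun i => ?_) l <;> simp [qhMult]

theorem goodClass_qh_one_one : GoodClass 1 (qhMult 1 1 1) := by
  convert! goodClass_line (show (0 : Fin (1 + 1)) ≠ 1 by decide) using 2 with l
  fin_cases l <;> rfl

/-- The monoid class with `d = 1`: its distinguished point is simple and counts among the five,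
while index `0` gets multiplicity zero. -/
theorem goodClass_qh_conic : GoodClass 2 (qhMult 0 5 1) := by
  convert! goodClass_monoid 1 (1 : Fin (5 + 1)) {0, 1}ᶜ (by decide) (by decide) using 2 with l
  fin_cases l <;> rfl

/-- After `q + 2` transformations all of `T` is used up, and together with `r` it makes up the `2 *
q + 5` points of multiplicity `q + 1`. -/
theorem goodClass_qh_deJonquieres (q : ℕ) :
    GoodClass (q + 2 + (q + 2) * q) (qhMult ((q + 2) * q) (2 * q + 5) (q + 1)) := by
  have hcard : ({0, 1}ᶜ : Finset (Fin (2 * q + 5 + 1))).card = 2 * q + 4 := by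
    rw [Finset.card_compl, Finset.card_pair (by simp)]
    simp
  convert! goodClass_deJonquieres q (q + 2) (0 : Fin (2 * q + 5 + 1)) 1 {0, 1}ᶜ {0, 1}ᶜ
    (by simp) (by simp) (by simp) subset_rfl hcard (by rw [hcard]; ring) using 2 with l
  refine Fin.cases ?_ (fun i => ?_) l
  · simp [qhMult]
  · simp only [qhMult, Fin.cons_succ, Fin.succ_ne_zero, if_false, Finset.mem_compl,
      Finset.mem_insert, Finset.mem_singleton, false_or]
    rw [if_pos (em _)]

theorem isIrreducibleMinusOneClass_one {d m₀ n : ℕ} (h : IsQHMinusOneClass d m₀ n 1) :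
    IsIrreducibleMinusOneClass d m₀ n 1 := by
  refine isIrreducibleMinusOneClass_of_goodClass h ?_
  obtain ⟨h1, h2⟩ := (isQHMinusOneClass_iff _ _ _ _).mp h
  push_cast at h1 h2
  have h3 : ((d : ℤ) - 1 - m₀) * (d + m₀ - 2) = 0 := by linear_combination h1 - h2
  rcases mul_eq_zero.mp h3 with h4 | h4
  · obtain rfl : d = m₀ + 1 := by omega
    obtain rfl : n = 2 * m₀ + 2 := by omega
    exact goodClass_qh_monoid m₀
  · have hd : d = 0 ∨ d = 1 ∨ d = 2 := by omega
    rcases hd with rfl | rfl | rfl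
    · omega
    · obtain rfl : m₀ = 1 := by omega
      obtain rfl : n = 1 := by omega
      exact goodClass_qh_one_one
    · obtain rfl : m₀ = 0 := by omega
      obtain rfl : n = 5 := by omega
      exact goodClass_qh_conic

theorem isIrreducibleMinusOneClass_deJonquieres {m : ℕ} (hm : 2 ≤ m) :
    IsIrreducibleMinusOneClass (m ^ 2 + m) (m ^ 2 - 1) (2 * m + 3) m := by
  obtain ⟨q, rfl⟩ : ∃ q, m = q + 1 := ⟨m - 1, by omega⟩
  have h1 : (q + 1) ^ 2 - 1 = (q + 2) * q := by
    rw [show (q + 1) ^ 2 = (q + 2) * q + 1 by ring, Nat.add_sub_cancel]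
  rw [h1, show (q + 1) ^ 2 + (q + 1) = q + 2 + (q + 2) * q by ring,
    show 2 * (q + 1) + 3 = 2 * q + 5 by ring]
  refine isIrreducibleMinusOneClass_of_goodClass ?_ (goodClass_qh_deJonquieres q)
  rw [isQHMinusOneClass_iff]
  push_cast
  constructor <;> ring

theorem eq_of_isQHMinusOneClass {d m₀ n m : ℕ} (hm : m ≤ 6) (h : IsQHMinusOneClass d m₀ n m) :
    m = 1 ∨ (2 ≤ m ∧ d = m ^ 2 + m ∧ m₀ = m ^ 2 - 1 ∧ n = 2 * m + 3) := by
  obtain ⟨h1, h2⟩ := (isQHMinusOneClass_iff _ _ _ _).mp h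
  -- Eliminating `n` leaves a factorization of a number depending on `m` only, so each `m > 1`
  -- admits finitely many candidates.
  have h3 : ((d : ℤ) - m₀ - m) * (d + m₀ - 2 * m) = (2 * m + 1) * (m - 1) := by
    linear_combination h1 - m * h2
  have aux : ∀ u v K : ℤ, 0 < K → u * v = K → -K ≤ u ∧ u ≤ K := fun u v K hK huv => by
    have hu : |u| ≤ K := Int.le_of_dvd hK ((abs_dvd u K).mpr ⟨v, huv.symm⟩)
    exact abs_le.mp hu
  generalize hu : (d : ℤ) - m₀ - m = u at h3
  generalize hv : (d : ℤ) + m₀ - 2 * m = v at h3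
  interval_cases m
  · push_cast at *
    have := Int.eq_one_or_neg_one_of_mul_eq_neg_one (by simpa using h3 : u * v = -1)
    rcases this with rfl | rfl <;> omega
  · exact Or.inl rfl
  all_goals
    refine Or.inr ⟨by norm_num, ?_⟩
    push_cast at *
    obtain ⟨hb1, hb2⟩ := aux u v _ (by norm_num) h3
    interval_cases u <;> omega

/-- Membership only bounds the multiplicities below, but self-intersection -1 makes their squares
add up to 27² + 1 = 730, already the sum for the bounds. So they are exact and
`generic_not_exists_irreducibleCurve` applies. -/
theorem generic_not_containsMinusOneCurve :
    ForGeneralPoints fun P : Fin (9 + 1) → Plane => ¬ ContainsMinusOneCurve 27 17 9 7 P := by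
  refine generic_not_exists_irreducibleCurve.forGeneralPoints fun a ha hno hC => ?_
  obtain ⟨F, hmem, hF⟩ := hC
  have hq : qhMult 17 9 7 = ![17, 7, 7, 7, 7, 7, 7, 7, 7, 7] := by
    funext i
    fin_cases i <;> rfl
  rw [hq] at hmem
  set P : Fin (9 + 1) → Plane := fun i => Projectivization.mk ℂ (a i) (ha i) with hP
  have hself := hF.self_intersection
  have hle := hmem.le_mult
  have hmult : ∀ i, multAt F (P i).rep = ![17, 7, 7, 7, 7, 7, 7, 7, 7, 7] i := by
    have hsq : ∑ i, (multAt F (P i).rep) ^ 2 =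
        ∑ i, (![17, 7, 7, 7, 7, 7, 7, 7, 7, 7] : Fin (9 + 1) → ℕ) i ^ 2 := by
      have h730 : ∑ i, (![17, 7, 7, 7, 7, 7, 7, 7, 7, 7] : Fin (9 + 1) → ℕ) i ^ 2 = 730 := by
        decide
      rw [h730]
      unfold selfIntersection at hself
      zify
      push_cast at hself
      linarith
    have h1 := (Finset.sum_eq_sum_iff_of_le fun i _ => Nat.pow_le_pow_left (hle i) 2).mp hsq.symm
    intro i
    exact (Nat.pow_left_injective (by norm_num : 2 ≠ 0) (h1 i (Finset.mem_univ i))).symm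
  have hI : IrreducibleCurve 27 ![17, 7, 7, 7, 7, 7, 7, 7, 7, 7] (fun i => (P i).rep) F :=
    ⟨hF.homogeneous, hF.irreducible, hmult⟩
  refine hno ⟨_, hI.substLin (mul_one 1) (mul_one 1) fun l => ?_⟩
  rw [act_one]
  obtain ⟨s, hs, h1⟩ := exists_rep_eq_smul (a l) (ha l)
  refine ⟨s⁻¹, inv_ne_zero hs, ?_⟩
  change _ = s⁻¹ • (Projectivization.mk ℂ (a l) (ha l)).rep
  rw [h1, smul_smul, inv_mul_cancel₀ hs, one_smul]

end PlaneCurves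

end

theorem mainTheorem11 :
    (∀ d m₀ n : ℕ, PlaneCurves.IsQHMinusOneClass d m₀ n 1 →
      PlaneCurves.IsIrreducibleMinusOneClass d m₀ n 1) ∧
    (∀ m : ℕ, 2 ≤ m →
      PlaneCurves.IsIrreducibleMinusOneClass (m ^ 2 + m) (m ^ 2 - 1) (2 * m + 3) m) ∧
    (∀ d m₀ n m : ℕ, m ≤ 6 → PlaneCurves.IsQHMinusOneClass d m₀ n m →
      PlaneCurves.IsIrreducibleMinusOneClass d m₀ n m) ∧
    (PlaneCurves.IsQHMinusOneClass 27 17 9 7 ∧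
      ¬ PlaneCurves.IsIrreducibleMinusOneClass 27 17 9 7 ∧
      PlaneCurves.ForGeneralPoints fun P : Fin (9 + 1) → PlaneCurves.Plane =>
        ¬ PlaneCurves.ContainsMinusOneCurve 27 17 9 7 P) := by
  refine ⟨fun d m₀ n h => PlaneCurves.isIrreducibleMinusOneClass_one h,
    fun m hm => PlaneCurves.isIrreducibleMinusOneClass_deJonquieres hm, fun d m₀ n m hm h => ?_,
    ?_, fun h => PlaneCurves.not_and_of_forGeneralPoints h.2
      PlaneCurves.generic_not_containsMinusOneCurve,
    PlaneCurves.generic_not_containsMinusOneCurve⟩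
  · rcases PlaneCurves.eq_of_isQHMinusOneClass hm h with rfl | ⟨h2, rfl, rfl, rfl⟩
    · exact PlaneCurves.isIrreducibleMinusOneClass_one h
    · exact PlaneCurves.isIrreducibleMinusOneClass_deJonquieres h2
  · rw [PlaneCurves.isQHMinusOneClass_iff]
    norm_num
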